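/- Let $N\ge 1$, let $a_1,\dots,a_{N-1}>0$ and $b_1,\dots,b_N\in\mathbb R$, and let $A$ be the $N\times N$ Jacobi matrix with diagonal $b_1,\dots,b_N$ and off-diagonal entries $a_1,\dots,a_{N-1}$. Let $\phi_0=0$, $\phi_1=1$ and $a_n\phi_{n+1}+a_{n-1}\phi_{n-1}+b_n\phi_n=\lambda\phi_n$ for $1\le n\le N$, where $a_N>0$ is an arbitrary normalization of $\phi_{N+1}$ and $a_0=1$. Let $\lambda_1,\dots,\lambda_N$ be the (real, distinct) zeros of $\phi_{N+1}$, put $\rho_k=\sum_{n=1}^N\phi_n(\lambda_k)^2$, and let $d\rho=\sum_{k=1}^N\rho_k^{-1}\delta_{\lambda_k}$ be the spectral measure. Fix $T>0$ and let $\mathcal F^T=L_2(0,T;\mathbb C)$ with $(f,g)_{\mathcal F^T}=\int_0^T f\,\overline g\,dt$. For $f\in\mathcal F^T$ let $u^f:[0,T]\to\mathbb C^N$ be the solution of $$u''-Au=(f,0,\dots,0)^{\mathsf T},\qquad u(0)=u'(0)=0,$$ ($u,u'$ absolutely continuous, the equation holding almost everywhere). Let $W^Tf=u^f(T)$, $C^T=(W^T)^*W^T$,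 $U^T=W^T\mathcal F^T$, let $(\mathbb F c)(z)=\sum_{k=1}^N c_k\phi_k(z)$ for $c\in\mathbb C^N$, $z\in\mathbb C$, and set $B_N=\mathbb F U^T$. For an entire function $E$ with $|E(z)|>|E(\overline z)|$ when $\operatorname{Im}z>0$ (a Hermite–Biehler function), $B(E)$ is the set of entire $F$ such that $F/E$ and $F^\#/E$ belong to the Hardy space $H_2$ of the upper half-plane, where $F^\#(z)=\overline{F(\overline z)}$, with the scalar product $[F,G]_{B(E)}=\frac1\pi\int_{\mathbb R}F\,\overline G\,|E|^{-2}\,d\lambda$. Here $H_2$ consists of the holomorphic $f$ on $\{\operatorname{Im} z>0\}$ with $\sup_{y>0}\int_{\mathbb R}|f(x+iy)|^2dx<\infty$. Then a solution $u^f$ exists for every $f\in\mathcal F^T$, its final state $u^f(T)$ is uniquely determined by $f$, $W^T$ is a bounded linear operator $\mathcal F^T\to\mathbb C^N$, and: 1. $B_N=\operatorname{Lin}\{\phi_1,\dots,\phi_N\}$ (complex span), which is the set of all complex polynomials of degree at most $N-1$. 2. For all $h,g\in\mathcal F^T$, with $H=\mathbb F u^h(T)$ and $G=\mathbb F u^g(T)$,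 one has $(C^Th,g)_{\mathcal F^T}=\int_{\mathbb R}H\,\overline{G}\,d\rho$. So $(H,G)_{B^T}:=(C^Th,g)_{\mathcal F^T}$ is a well-defined scalar product on $B_N$, namely that of $L_{2,\rho}$. 3. $B_N$ with this scalar product is a de Branges space. There is $J_i\in B_N$ with $(G,J_i)_{B^T}=G(i)$ for all $G\in B_N$, the function $$E(z)=(1-iz)\,J_i(z)\,\|J_i\|_{B^T}^{-1}$$ is a Hermite–Biehler function, $B_N=B(E)$ as sets of functions, and $(H,G)_{B^T}=[H,G]_{B(E)}$ for all $H,G\in B_N$. -/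

import Mathlib

open MeasureTheory Polynomial

noncomputable section

namespace JacobiDeBranges

/-- The finite Jacobi matrix with diagonal `b 1, …, b N` and off-diagonal `a 1, …, a (N - 1)`.
The row or column with index `i : Fin N` is the one numbered `i + 1` in the usual numbering. -/
def jacobiMatrix (N : ℕ) (a b : ℕ → ℝ) : Matrix (Fin N) (Fin N) ℝ :=
  Matrix.of fun i j =>
    if i = j then b (i + 1)
    else if (i : ℕ) + 1 = j then a (i + 1)
    else if (j : ℕ) + 1 = i then a (j + 1)
    else 0

/-- The polynomials `φ n` with `φ 1 = 1` and
`a n * φ (n+1) + a (n-1) * φ (n-1) + b n * φ n = X * φ n` for `n ≥ 1`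
(with the auxiliary value `φ 0 = 0`, which makes `a 0` irrelevant). -/
def phi (a b : ℕ → ℝ) : ℕ → ℝ[X]
  | 0 => 0
  | 1 => 1
  | n + 2 => C (a (n + 1))⁻¹ * ((X - C (b (n + 1))) * phi a b (n + 1) - C (a n) * phi a b n)

/-- The polynomial `a_N φ_{N+1}`. It has the same zeros as `φ_{N+1}` for each `a_N > 0`, and
needs only `a 1, …, a (N - 1)`. -/
def spectralPolynomial (N : ℕ) (a b : ℕ → ℝ) : ℝ[X] :=
  (X - C (b N)) * phi a b N - C (a (N - 1)) * phi a b (N - 1)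

/-- The norming constant `∑ₖ φₖ(l)²`, `k = 1, …, N`. -/
def normingConstant (N : ℕ) (a b : ℕ → ℝ) (l : ℝ) : ℝ :=
  ∑ k : Fin N, ((phi a b (k + 1)).eval l) ^ 2

/-- The spectral measure `dρ = ∑ₖ ρₖ⁻¹ δ_{λₖ}`. -/
def spectralMeasure (N : ℕ) (a b : ℕ → ℝ) : Measure ℝ :=
  ∑ l ∈ (spectralPolynomial N a b).roots.toFinset,
    ENNReal.ofReal (1 / normingConstant N a b l) • Measure.dirac l

/-- The space of controls `L₂(0,T;ℂ)`. -/
abbrev Control (T : ℝ) : Type := Lp ℂ 2 (volume.restrict (Set.Ioo (0 : ℝ) T))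

/-- `u` solves `u'' - A u = (f, 0, …, 0)` on `[0,T]`, `u(0) = u'(0) = 0`, for a control
`f ∈ L₂(0,T)`: `u` is continuously differentiable with derivative `v`, `v` is absolutely
continuous, and the equation holds almost everywhere. This is written in integrated form. -/
def IsSolution (N : ℕ) [NeZero N] (a b : ℕ → ℝ) (T : ℝ) (f : Control T)
    (u : ℝ → EuclideanSpace ℂ (Fin N)) : Prop :=
  ∃ v : ℝ → EuclideanSpace ℂ (Fin N),
    ContinuousOn u (Set.Icc 0 T) ∧ ContinuousOn v (Set.Icc 0 T) ∧
    (∀ t ∈ Set.Icc 0 T, u t = ∫ s in (0 : ℝ)..t, v s) ∧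
    (∀ t ∈ Set.Icc 0 T, v t = ∫ s in (0 : ℝ)..t,
      (Matrix.toEuclideanLin ((jacobiMatrix N a b).map Complex.ofReal) (u s)
        + EuclideanSpace.single (0 : Fin N) (f s)))

/-- The reachable set `U^T` of the states `u^f(T)`. -/
def reachableSet (N : ℕ) [NeZero N] (a b : ℕ → ℝ) (T : ℝ) : Set (EuclideanSpace ℂ (Fin N)) :=
  {x | ∃ (f : Control T) (u : ℝ → EuclideanSpace ℂ (Fin N)), IsSolution N a b T f u ∧ u T = x}

/-- `W` is the control operator `f ↦ u^f(T)`. At most one `W` satisfies this. -/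
def IsControlOperator (N : ℕ) [NeZero N] (a b : ℕ → ℝ) (T : ℝ)
    (W : Control T →L[ℂ] EuclideanSpace ℂ (Fin N)) : Prop :=
  ∀ f : Control T, (∃ u, IsSolution N a b T f u) ∧ ∀ u, IsSolution N a b T f u → W f = u T

/-- The connecting operator `W* W`. -/
def connectingOperator {N : ℕ} {T : ℝ} (W : Control T →L[ℂ] EuclideanSpace ℂ (Fin N)) :
    Control T →L[ℂ] Control T :=
  (ContinuousLinearMap.adjoint W).comp W

/-- The form `(C h, g) = ∫₀ᵀ (C h)(t) conj (g t) dt`, linear in `h`, where `C = W* W`. -/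
def connectingForm {N : ℕ} {T : ℝ} (W : Control T →L[ℂ] EuclideanSpace ℂ (Fin N))
    (h g : Control T) : ℂ :=
  inner ℂ g (connectingOperator W h)

/-- The Fourier transform `c ↦ ∑ₖ cₖ φₖ(z)`. -/
def fourier (N : ℕ) (a b : ℕ → ℝ) (c : EuclideanSpace ℂ (Fin N)) : ℂ → ℂ :=
  fun z => ∑ k : Fin N, c k * aeval z (phi a b (k + 1))

/-- The set `B_N` of Fourier images of the reachable states. -/
def fourierReachable (N : ℕ) [NeZero N] (a b : ℕ → ℝ) (T : ℝ) : Set (ℂ → ℂ) :=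
  fourier N a b '' reachableSet N a b T

/-- Entire functions `E` with `|E(z)| > |E(conj z)|` in the open upper half-plane. -/
def IsHermiteBiehler (E : ℂ → ℂ) : Prop :=
  Differentiable ℂ E ∧ ∀ z : ℂ, 0 < z.im → ‖E (starRingEnd ℂ z)‖ < ‖E z‖

/-- The involution `F#(z) = conj (F (conj z))`. -/
def sharp (F : ℂ → ℂ) : ℂ → ℂ := fun z => starRingEnd ℂ (F (starRingEnd ℂ z))

/-- Membership in the Hardy space `H₂` of the upper half-plane. -/
def MemHardy (f : ℂ → ℂ) : Prop :=
  DifferentiableOn ℂ f {z : ℂ | 0 < z.im} ∧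
  ∃ M : NNReal, ∀ y : ℝ, 0 < y →
    ∫⁻ x : ℝ, ‖f ((x : ℂ) + (y : ℂ) * Complex.I)‖ₑ ^ 2 ≤ (M : ENNReal)

/-- The set of functions of the de Branges space `B(E)`. -/
def deBrangesSpace (E : ℂ → ℂ) : Set (ℂ → ℂ) :=
  {F | Differentiable ℂ F ∧ MemHardy (fun z => F z / E z) ∧ MemHardy (fun z => sharp F z / E z)}

/-- The scalar product `[F,G] = π⁻¹ ∫ F conj(G) / |E|²` of `B(E)`. -/
def deBrangesInner (E F G : ℂ → ℂ) : ℂ :=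
  (1 / (Real.pi : ℂ)) *
    ∫ x : ℝ, F (x : ℂ) * starRingEnd ℂ (G (x : ℂ)) / ((‖E (x : ℂ)‖ ^ 2 : ℝ) : ℂ)

end JacobiDeBranges

end

/-! Everything is transported to `ℂ^N` with its Euclidean product. By definition `(C h, g) = ⟨W h, W
g⟩`, so it suffices to show that `W` is onto and that the transform `c ↦ ∑ cₖ φₖ` is an isometry
from `ℂ^N` both into `L₂` of the spectral measure and onto `B(E)`.

Surjectivity (`exists_controlOperator_surjective`): by Duhamel, `W f = ∫ f(s) p(T - s) ds` with `p''
= A p`, `p(0) = 0`, `p'(0) = e₁`. A vector `y` orthogonal to the range satisfies `⟨p(t), y⟩ = 0` on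
`(0,T)`. Such vectors form a set that is invariant under the symmetric matrix `A` (differentiate
twice) and orthogonal to `e₁` (differentiate once and let `t → 0`). Since `e₁` is cyclic for `A`, `y
= 0`. The transform image of `ℂ^N` is all polynomials of degree below `N`, because `φₖ` has degree
`k - 1`.

Both isometries rest on one remark, `eq_ite_of_reproducing`: if the Gram matrix `B` of the `φⱼ`
satisfies `∑ₖ Bⱼₖ φₖ(w) = φⱼ(w)` at `N` points `w`, then `B` is the identity. This is a reproducing
property of `K(z,w) = ∑ φₖ(z) φₖ(w)`. For the spectral measure it is tested at the eigenvalues,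
where Christoffel–Darboux gives `K(λ,μ) = 0` for `λ ≠ μ`. For the weight `|E|⁻² / π` it is tested in
the upper half-plane, using the de Branges formula `E(z) E#(w) - E#(z) E(w) = -2i (z - w) K(z,w)`
and Cauchy's theorem (`integral_phi_mul_kernel`).

Finally, `E` is a polynomial of degree `N` without zeros in the closed upper half-plane, and for
such `E` the space `B(E)` is exactly the polynomials of degree below `N`
(`deBrangesSpace_eq_polynomials`): the Hardy condition gives polynomial growth off the real line,
and a maximum principle argument carries it across. -/

noncomputable section

namespace JacobiDeBranges

/-! ### The polynomials `φₖ`: degrees, Christoffel–Darboux, the kernel, the span. -/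

section Polynomials

variable {N : ℕ} {a b : ℕ → ℝ}

/-- The recurrence for `φ`, solved for the next polynomial. -/
lemma C_mul_phi_succ {n : ℕ} (hn : 1 ≤ n) (han : a n ≠ 0) :
    C (a n) * phi a b (n + 1) = spectralPolynomial n a b := by
  obtain ⟨m, rfl⟩ : ∃ m, n = m + 1 := ⟨n - 1, by omega⟩
  rw [phi, ← mul_assoc, ← C_mul, mul_inv_cancel₀ han, C_1, one_mul]
  rfl

lemma spectralPolynomial_succ (n : ℕ) :
    spectralPolynomial (n + 1) a b =
      (X - C (b (n + 1))) * phi a b (n + 1) - C (a n) * phi a b n := rfl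

/-- Each step of the recurrence multiplies the leading coefficient by `1 / a n`, which is nonzero.
The nonvanishing coefficient is carried along because `natDegree` alone does not exclude the zero
polynomial. -/
lemma natDegree_phi (ha : ∀ n : ℕ, 1 ≤ n → n < N → 0 < a n) :
    ∀ n, n < N → (phi a b (n + 1)).natDegree = n ∧ (phi a b (n + 1)).coeff n ≠ 0
  | 0, _ => by simp [phi]
  | 1, h => by
      have h1 := (ha 1 le_rfl h).ne'
      have : phi a b (1 + 1) = C (a 1)⁻¹ * (X - C (b 1)) := by simp [phi]
      rw [this]
      refine ⟨by rw [natDegree_C_mul (inv_ne_zero h1), natDegree_X_sub_C], ?_⟩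
      simpa [coeff_C] using h1
  | n + 2, h => by
      have h1 := (ha (n + 2) (by omega) h).ne'
      obtain ⟨d1, c1⟩ := natDegree_phi ha (n + 1) (by omega)
      obtain ⟨d0, c0⟩ := natDegree_phi ha n (by omega)
      have hco : (phi a b (n + 2 + 1)).coeff (n + 2) =
          (a (n + 2))⁻¹ * (phi a b (n + 1 + 1)).coeff (n + 1) := by
        have e1 : (phi a b (n + 1 + 1)).coeff (n + 2) = 0 :=
          coeff_eq_zero_of_natDegree_lt (by omega)
        have e0 : (phi a b (n + 1)).coeff (n + 2) = 0 := coeff_eq_zero_of_natDegree_lt (by omega)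
        rw [phi, coeff_C_mul, coeff_sub, sub_mul, coeff_sub, coeff_X_mul, coeff_C_mul, coeff_C_mul,
          e1, e0]
        simp
      have hne : (phi a b (n + 2 + 1)).coeff (n + 2) ≠ 0 := by
        rw [hco]; exact mul_ne_zero (inv_ne_zero h1) c1
      refine ⟨natDegree_eq_of_le_of_coeff_ne_zero ?_ hne, hne⟩
      rw [phi]
      refine (natDegree_C_mul_le _ _).trans ((natDegree_sub_le _ _).trans (max_le ?_ ?_))
      · refine natDegree_mul_le.trans ?_
        rw [natDegree_X_sub_C, d1]; omega
      · refine (natDegree_C_mul_le _ _).trans ?_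
        omega

lemma natDegree_spectralPolynomial [NeZero N] (ha : ∀ n : ℕ, 1 ≤ n → n < N → 0 < a n) :
    (spectralPolynomial N a b).natDegree = N ∧ (spectralPolynomial N a b).coeff N ≠ 0 := by
  obtain ⟨m, rfl⟩ : ∃ m, N = m + 1 := ⟨N - 1, by have := NeZero.pos N; omega⟩
  obtain ⟨d1, c1⟩ := natDegree_phi (b := b) ha m (by omega)
  have d0 : (phi a b m).natDegree ≤ m := by
    rcases m with _ | m
    · simp [phi]
    · rw [(natDegree_phi (b := b) ha m (by omega)).1]; omega
  have hco : (spectralPolynomial (m + 1) a b).coeff (m + 1) = (phi a b (m + 1)).coeff m := by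
    have e1 : (phi a b (m + 1)).coeff (m + 1) = 0 := coeff_eq_zero_of_natDegree_lt (by omega)
    have e0 : (phi a b m).coeff (m + 1) = 0 := coeff_eq_zero_of_natDegree_lt (by omega)
    rw [spectralPolynomial_succ, coeff_sub, sub_mul, coeff_sub, coeff_X_mul, coeff_C_mul,
      coeff_C_mul, e1, e0]
    simp
  have hne : (spectralPolynomial (m + 1) a b).coeff (m + 1) ≠ 0 := by rwa [hco]
  refine ⟨natDegree_eq_of_le_of_coeff_ne_zero ?_ hne, hne⟩
  rw [spectralPolynomial_succ]
  refine (natDegree_sub_le _ _).trans (max_le ?_ ?_)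
  · refine natDegree_mul_le.trans ?_
    rw [natDegree_X_sub_C, d1]; omega
  · refine (natDegree_C_mul_le _ _).trans ?_
    omega

/-- The Christoffel–Darboux identity. -/
lemma christoffel_darboux_range {R : Type*} [CommRing R] [Algebra ℝ R]
    (ha : ∀ n : ℕ, 1 ≤ n → n < N → 0 < a n) (z w : R) (n : ℕ) (hn : n < N) :
    (z - w) * ∑ k ∈ Finset.range (n + 1), aeval z (phi a b (k + 1)) * aeval w (phi a b (k + 1)) =
      aeval z (spectralPolynomial (n + 1) a b) * aeval w (phi a b (n + 1)) -
        aeval z (phi a b (n + 1)) * aeval w (spectralPolynomial (n + 1) a b) := by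
  induction n with
  | zero => simp [phi, spectralPolynomial]
  | succ n ih =>
    rw [Finset.sum_range_succ, mul_add, ih (by omega),
      -- The old boundary term is rewritten as `a_{n+1} φ_{n+2}`. Only the final one keeps the form
      -- of `spectralPolynomial`, so no value `a N` is needed.
      ← C_mul_phi_succ (b := b) (Nat.succ_pos n) (ha (n + 1) (by omega) hn).ne',
      spectralPolynomial_succ (n + 1)]
    simp only [map_sub, map_mul, aeval_X, aeval_C]
    ring

/-- The confluent Christoffel–Darboux identity. -/
lemma christoffel_darboux_confluent_range
    (ha : ∀ n : ℕ, 1 ≤ n → n < N → 0 < a n) (n : ℕ) (hn : n < N) :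
    ∑ k ∈ Finset.range (n + 1), phi a b (k + 1) ^ 2 =
      derivative (spectralPolynomial (n + 1) a b) * phi a b (n + 1) -
        derivative (phi a b (n + 1)) * spectralPolynomial (n + 1) a b := by
  induction n with
  | zero => simp [phi, spectralPolynomial]
  | succ n ih =>
    rw [Finset.sum_range_succ, ih (by omega),
      ← C_mul_phi_succ (b := b) (Nat.succ_pos n) (ha (n + 1) (by omega) hn).ne',
      spectralPolynomial_succ (n + 1)]
    simp only [derivative_sub, derivative_mul, derivative_X, derivative_C]
    ring

/-- The reproducing kernel `∑ₖ φₖ(z) φₖ(w)`. -/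
def kernel (N : ℕ) (a b : ℕ → ℝ) (z w : ℂ) : ℂ :=
  ∑ k : Fin N, aeval z (phi a b (k + 1)) * aeval w (phi a b (k + 1))

lemma sub_mul_kernel [NeZero N] (ha : ∀ n : ℕ, 1 ≤ n → n < N → 0 < a n) (z w : ℂ) :
    (z - w) * kernel N a b z w =
      aeval z (spectralPolynomial N a b) * aeval w (phi a b N) -
        aeval z (phi a b N) * aeval w (spectralPolynomial N a b) := by
  obtain ⟨m, rfl⟩ : ∃ m, N = m + 1 := ⟨N - 1, by have := NeZero.pos N; omega⟩
  rw [← christoffel_darboux_range ha z w m (by omega), kernel,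
    ← Fin.sum_univ_eq_sum_range (fun k => aeval z (phi a b (k + 1)) * aeval w (phi a b (k + 1)))]

lemma normingConstant_eq [NeZero N] (ha : ∀ n : ℕ, 1 ≤ n → n < N → 0 < a n) (x : ℝ) :
    normingConstant N a b x =
      (derivative (spectralPolynomial N a b)).eval x * (phi a b N).eval x -
        (derivative (phi a b N)).eval x * (spectralPolynomial N a b).eval x := by
  obtain ⟨m, rfl⟩ : ∃ m, N = m + 1 := ⟨N - 1, by have := NeZero.pos N; omega⟩
  have := congrArg (eval x) (christoffel_darboux_confluent_range (b := b) ha m (by omega))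
  rw [eval_sub, eval_mul, eval_mul] at this
  rw [← this, eval_finsetSum, normingConstant,
    ← Fin.sum_univ_eq_sum_range (fun k => eval x (phi a b (k + 1) ^ 2))]
  simp

lemma aeval_conj_real (p : ℝ[X]) (z : ℂ) :
    aeval (starRingEnd ℂ z) p = starRingEnd ℂ (aeval z p) :=
  aeval_conj p z

lemma aeval_ofReal_eq (p : ℝ[X]) (x : ℝ) : aeval (x : ℂ) p = ((p.eval x : ℝ) : ℂ) := by
  rw [← Complex.coe_algebraMap, aeval_algebraMap_apply]
  simp

lemma kernel_conj_self (z : ℂ) :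
    kernel N a b z (starRingEnd ℂ z) =
      ((∑ k : Fin N, ‖aeval z (phi a b (k + 1))‖ ^ 2 : ℝ) : ℂ) := by
  simp [kernel, aeval_conj_real, Complex.mul_conj']

/-- The term of `φ₁ = 1` already contributes 1. This bound is the source of all positivity below. -/
lemma one_le_sum_norm_sq [NeZero N] (z : ℂ) :
    1 ≤ ∑ k : Fin N, ‖aeval z (phi a b (k + 1))‖ ^ 2 := by
  refine le_trans (by simp [phi]) (Finset.single_le_sum
    (f := fun k : Fin N => ‖aeval z (phi a b (k + 1))‖ ^ 2) (fun _ _ => by positivity)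
    (Finset.mem_univ (0 : Fin N)))

lemma kernel_ofReal_self (x : ℝ) :
    kernel N a b x x = ((normingConstant N a b x : ℝ) : ℂ) := by
  simp [kernel, normingConstant, aeval_ofReal_eq, pow_two]

lemma one_le_normingConstant [NeZero N] (x : ℝ) : 1 ≤ normingConstant N a b x := by
  refine le_trans (by simp [phi]) (Finset.single_le_sum
    (f := fun k : Fin N => (phi a b (k + 1)).eval x ^ 2) (fun _ _ => by positivity)
    (Finset.mem_univ (0 : Fin N)))

/-! ### The span of the polynomials -/

/-- `φ_{k+1}` with complex coefficients. -/
abbrev phiC (a b : ℕ → ℝ) (k : ℕ) : ℂ[X] := (phi a b (k + 1)).map (algebraMap ℝ ℂ)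

lemma degree_phiC (ha : ∀ n : ℕ, 1 ≤ n → n < N → 0 < a n) (k : ℕ) (hk : k < N) :
    (phiC a b k).degree = k := by
  rw [degree_map, degree_eq_natDegree, (natDegree_phi ha k hk).1]
  intro h
  apply (natDegree_phi (b := b) ha k hk).2
  simp [h]

lemma linearIndependent_phiC (ha : ∀ n : ℕ, 1 ≤ n → n < N → 0 < a n) :
    LinearIndependent ℂ fun k : Fin N => phiC a b k := by
  let S : Polynomial.Sequence ℂ :=
    -- The degree of `φ_{k+1}` is controlled only for `k < N`, so the sequence is padded with
    -- monomials to have one polynomial of each degree.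
    { elems' := fun k => if k < N then phiC a b k else X ^ k
      degree_eq' := fun k => by
        split_ifs with h
        · exact degree_phiC ha k h
        · exact degree_X_pow k }
  convert! S.linearIndependent.comp (Fin.val : Fin N → ℕ) Fin.val_injective with k
  exact (if_pos k.2).symm

lemma span_phiC (ha : ∀ n : ℕ, 1 ≤ n → n < N → 0 < a n) :
    Submodule.span ℂ (Set.range fun k : Fin N => phiC a b k) = degreeLT ℂ N := by
  refine Submodule.eq_of_le_of_finrank_eq (Submodule.span_le.2 ?_) ?_
  · rintro _ ⟨k, rfl⟩
    simp only [SetLike.mem_coe, mem_degreeLT, degree_phiC ha k k.2]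
    exact_mod_cast k.2
  · rw [finrank_span_eq_card (linearIndependent_phiC ha), (degreeLTEquiv ℂ N).finrank_eq]
    simp

/-- The polynomial `∑ₖ cₖ φₖ`. -/
def fourierPolynomial (N : ℕ) (a b : ℕ → ℝ) (c : EuclideanSpace ℂ (Fin N)) : ℂ[X] :=
  ∑ k : Fin N, c k • phiC a b k

lemma eval_fourierPolynomial (c : EuclideanSpace ℂ (Fin N)) (z : ℂ) :
    (fourierPolynomial N a b c).eval z = fourier N a b c z := by
  simp [fourierPolynomial, fourier, eval_finsetSum, aeval_def, eval_map]

lemma degree_fourierPolynomial_lt (ha : ∀ n : ℕ, 1 ≤ n → n < N → 0 < a n)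
    (c : EuclideanSpace ℂ (Fin N)) : (fourierPolynomial N a b c).degree < N := by
  rw [← mem_degreeLT, ← span_phiC (b := b) ha]
  exact Submodule.sum_mem _ fun k _ => Submodule.smul_mem _ _ (Submodule.subset_span ⟨k, rfl⟩)

lemma exists_fourierPolynomial_eq (ha : ∀ n : ℕ, 1 ≤ n → n < N → 0 < a n)
    {p : ℂ[X]} (hp : p.degree < N) : ∃ c, fourierPolynomial N a b c = p := by
  rw [← mem_degreeLT, ← span_phiC (b := b) ha, Submodule.mem_span_range_iff_exists_fun] at hp
  obtain ⟨c, hc⟩ := hp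
  exact ⟨WithLp.toLp 2 c, hc⟩

lemma fourierPolynomial_injective (ha : ∀ n : ℕ, 1 ≤ n → n < N → 0 < a n) :
    Function.Injective (fourierPolynomial N a b) := by
  intro c d h
  ext k
  have := (Fintype.linearIndependent_iff.1 (linearIndependent_phiC (b := b) ha)) (fun k => c k - d k)
    (by simpa [fourierPolynomial, sub_smul, sub_eq_zero] using h) k
  exact sub_eq_zero.1 this

lemma range_fourier_eq_polynomials (ha : ∀ n : ℕ, 1 ≤ n → n < N → 0 < a n) :
    Set.range (fourier N a b) =
      {F : ℂ → ℂ | ∃ p : ℂ[X], p.degree < (N : WithBot ℕ) ∧ ∀ z, F z = p.eval z} := by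
  ext F
  constructor
  · rintro ⟨c, rfl⟩
    exact ⟨_, degree_fourierPolynomial_lt ha c, fun z => (eval_fourierPolynomial c z).symm⟩
  · rintro ⟨p, hp, hF⟩
    obtain ⟨c, rfl⟩ := exists_fourierPolynomial_eq (b := b) ha hp
    exact ⟨c, funext fun z => by rw [hF, eval_fourierPolynomial]⟩

lemma range_fourier_eq_span :
    Set.range (fourier N a b) =
      (Submodule.span ℂ (Set.range fun k : Fin N =>
          fun z : ℂ => aeval z (phi a b (k + 1))) : Set (ℂ → ℂ)) := by
  ext F
  rw [SetLike.mem_coe, Submodule.mem_span_range_iff_exists_fun]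
  constructor
  · rintro ⟨c, rfl⟩
    exact ⟨c, by ext z; simp [fourier]⟩
  · rintro ⟨c, rfl⟩
    exact ⟨WithLp.toLp 2 c, by ext z; simp [fourier]⟩

/-- A kernel that reproduces each `φⱼ` at infinitely many points consists of Kronecker deltas. -/
lemma eq_ite_of_reproducing (ha : ∀ n : ℕ, 1 ≤ n → n < N → 0 < a n) (B : Fin N → Fin N → ℂ)
    (s : Set ℂ) (hs : s.Infinite ∨ ∃ t : Finset ℂ, (t : Set ℂ) ⊆ s ∧ N ≤ t.card)
    (h : ∀ j, ∀ w ∈ s, ∑ k : Fin N, B j k * aeval w (phi a b (k + 1)) = aeval w (phi a b (j + 1)))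
    (j k : Fin N) : B j k = if j = k then 1 else 0 := by
  obtain ⟨t, hts, htc⟩ : ∃ t : Finset ℂ, (t : Set ℂ) ⊆ s ∧ N ≤ t.card := by
    rcases hs with hs | hs
    · obtain ⟨t, ht, h⟩ := hs.exists_subset_card_eq N
      exact ⟨t, ht, h.ge⟩
    · exact hs
  -- The polynomials `∑ₖ Bⱼₖ φₖ` and `φⱼ` have degree below `N` and agree at `N` points, hence
  -- coincide; independence of the `φₖ` then compares coefficients.
  have key : fourierPolynomial N a b (WithLp.toLp 2 (B j)) =
      fourierPolynomial N a b (EuclideanSpace.single j 1) := by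
    refine Polynomial.eq_of_degrees_lt_of_eval_finset_eq t
      ((degree_fourierPolynomial_lt ha _).trans_le (by exact_mod_cast htc))
      ((degree_fourierPolynomial_lt ha _).trans_le (by exact_mod_cast htc)) fun w hw => ?_
    rw [eval_fourierPolynomial, eval_fourierPolynomial]
    simpa [fourier, Pi.single_apply] using h j w (hts hw)
  have := congrArg (fun c : EuclideanSpace ℂ (Fin N) => c k) (fourierPolynomial_injective ha key)
  simpa [Pi.single_apply, eq_comm] using this

end Polynomials

/-! ### The Hermite–Biehler polynomial `E`. -/

section HermiteBiehler

variable {N : ℕ} {a b : ℕ → ℝ}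

/-- The squared norm of the reproducing kernel at `i`. -/
def kernelNormSq (N : ℕ) (a b : ℕ → ℝ) : ℝ :=
  ∑ k : Fin N, ‖aeval Complex.I (phi a b (k + 1))‖ ^ 2

lemma one_le_kernelNormSq [NeZero N] : 1 ≤ kernelNormSq N a b := one_le_sum_norm_sq _

lemma kernel_I_neg_I : kernel N a b Complex.I (-Complex.I) = (kernelNormSq N a b : ℂ) := by
  rw [← Complex.conj_I, kernel_conj_self, kernelNormSq]

lemma sqrt_kernelNormSq_mul_self [NeZero N] :
    ((√(kernelNormSq N a b) : ℝ) : ℂ) * ((√(kernelNormSq N a b) : ℝ) : ℂ) =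
      (kernelNormSq N a b : ℂ) := by
  rw [← Complex.ofReal_mul, Real.mul_self_sqrt]
  linarith [one_le_kernelNormSq (N := N) (a := a) (b := b)]

lemma sqrt_kernelNormSq_ne_zero [NeZero N] : ((√(kernelNormSq N a b) : ℝ) : ℂ) ≠ 0 := by
  have := one_le_kernelNormSq (N := N) (a := a) (b := b)
  exact_mod_cast (Real.sqrt_pos.2 (by linarith)).ne'

/-- The Hermite–Biehler function `E`, as a polynomial. -/
def structurePolynomial (N : ℕ) (a b : ℕ → ℝ) : ℂ[X] :=
  C (-Complex.I / (√(kernelNormSq N a b) : ℝ)) *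
    (C (aeval (-Complex.I) (phi a b N)) * (spectralPolynomial N a b).map (algebraMap ℝ ℂ) -
      C (aeval (-Complex.I) (spectralPolynomial N a b)) * (phi a b N).map (algebraMap ℝ ℂ))

lemma eval_structurePolynomial (z : ℂ) :
    (structurePolynomial N a b).eval z = -Complex.I / (√(kernelNormSq N a b) : ℝ) *
      (aeval z (spectralPolynomial N a b) * aeval (-Complex.I) (phi a b N) -
        aeval z (phi a b N) * aeval (-Complex.I) (spectralPolynomial N a b)) := by
  simp only [structurePolynomial, eval_mul, eval_C, eval_sub, eval_map_algebraMap]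
  ring

/-- Since `1 - iz = -i (z + i)`, this is Christoffel–Darboux at `w = -i`. Here `K(z,-i)` is
`J_i(z)`, as `φₖ(-i)` is the conjugate of `φₖ(i)`. -/
lemma eval_structurePolynomial_eq_kernel [NeZero N] (ha : ∀ n : ℕ, 1 ≤ n → n < N → 0 < a n)
    (z : ℂ) :
    (structurePolynomial N a b).eval z =
      (1 - Complex.I * z) * kernel N a b z (-Complex.I) / (√(kernelNormSq N a b) : ℝ) := by
  rw [eval_structurePolynomial, ← sub_mul_kernel ha]
  linear_combination (-kernel N a b z (-Complex.I) / (√(kernelNormSq N a b) : ℝ)) * Complex.I_mul_I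

lemma sharp_structurePolynomial (z : ℂ) :
    sharp (fun z => (structurePolynomial N a b).eval z) z =
      Complex.I / (√(kernelNormSq N a b) : ℝ) *
      (aeval z (spectralPolynomial N a b) * aeval Complex.I (phi a b N) -
        aeval z (phi a b N) * aeval Complex.I (spectralPolynomial N a b)) := by
  have : (-Complex.I) = starRingEnd ℂ Complex.I := Complex.conj_I.symm
  rw [sharp, eval_structurePolynomial, this]
  simp only [aeval_conj_real, map_mul, map_sub, map_div₀, Complex.conj_conj, Complex.conj_ofReal]

/-- A zero at `-i` comes with one at `i`, and then Christoffel–Darboux gives `2i K(i,-i) = 0`,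
although `K(i,-i) ≥ 1`. This number is a factor of the leading coefficient of `E`. -/
lemma phi_neg_I_ne_zero [NeZero N] (ha : ∀ n : ℕ, 1 ≤ n → n < N → 0 < a n) :
    aeval (-Complex.I) (phi a b N) ≠ 0 := by
  intro h
  have h' : aeval Complex.I (phi a b N) = 0 := by
    rw [← Complex.conj_I, aeval_conj_real] at h
    simpa using h
  have key := sub_mul_kernel (b := b) ha Complex.I (-Complex.I)
  rw [h, h', mul_zero, zero_mul, sub_zero, kernel_I_neg_I] at key
  have h1 := one_le_kernelNormSq (N := N) (a := a) (b := b)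
  rcases mul_eq_zero.1 key with h2 | h2
  · simp [Complex.ext_iff] at h2
  · rw [Complex.ofReal_eq_zero] at h2
    linarith

lemma natDegree_structurePolynomial [NeZero N] (ha : ∀ n : ℕ, 1 ≤ n → n < N → 0 < a n) :
    (structurePolynomial N a b).natDegree = N ∧ structurePolynomial N a b ≠ 0 := by
  obtain ⟨dQ, cQ⟩ := natDegree_spectralPolynomial (b := b) ha
  have hN := NeZero.pos N
  have dP : (phi a b N).natDegree < N := by
    have := (natDegree_phi (b := b) ha (N - 1) (by omega)).1
    rw [Nat.sub_add_cancel hN] at this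
    omega
  have hne : (structurePolynomial N a b).coeff N ≠ 0 := by
    simp only [structurePolynomial, coeff_C_mul, coeff_sub, coeff_map,
      coeff_eq_zero_of_natDegree_lt dP, map_zero, mul_zero, sub_zero]
    refine mul_ne_zero (div_ne_zero (neg_ne_zero.2 Complex.I_ne_zero) sqrt_kernelNormSq_ne_zero)
      (mul_ne_zero (phi_neg_I_ne_zero ha) ?_)
    simpa using cQ
  refine ⟨natDegree_eq_of_le_of_coeff_ne_zero ?_ hne, fun h => hne (by simp [h])⟩
  refine (natDegree_C_mul_le _ _).trans ((natDegree_sub_le _ _).trans (max_le ?_ ?_))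
  · refine (natDegree_C_mul_le _ _).trans ?_
    rw [natDegree_map, dQ]
  · refine (natDegree_C_mul_le _ _).trans ?_
    rw [natDegree_map]; exact dP.le

/-- The de Branges formula for the reproducing kernel. -/
lemma structurePolynomial_mul_sharp_sub [NeZero N] (ha : ∀ n : ℕ, 1 ≤ n → n < N → 0 < a n)
    (z w : ℂ) :
    (structurePolynomial N a b).eval z * sharp (fun z => (structurePolynomial N a b).eval z) w -
      sharp (fun z => (structurePolynomial N a b).eval z) z * (structurePolynomial N a b).eval w =
      -2 * Complex.I * ((z - w) * kernel N a b z w) := by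
  -- Both `E` and `E#` are combinations of the same two polynomials, so the left side is their 2×2
  -- determinant in `z, w` times a constant. That constant is read off from the case `(i, -i)`,
  -- which produces the squared norm of `J_i`.
  have hI := sub_mul_kernel (b := b) ha Complex.I (-Complex.I)
  rw [kernel_I_neg_I, ← sqrt_kernelNormSq_mul_self] at hI
  rw [sub_mul_kernel ha, sharp_structurePolynomial, sharp_structurePolynomial,
    eval_structurePolynomial, eval_structurePolynomial]
  have hs := sqrt_kernelNormSq_ne_zero (N := N) (a := a) (b := b)
  set s : ℂ := ((√(kernelNormSq N a b) : ℝ) : ℂ)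
  field_simp
  linear_combination (aeval z (spectralPolynomial N a b) * aeval w (phi a b N) -
    aeval z (phi a b N) * aeval w (spectralPolynomial N a b)) *
      (-Complex.I * hI + 2 * s ^ 2 * Complex.I_mul_I)

/-- The de Branges formula at `w = conj z`; positivity of the kernel there is the Hermite–Biehler
inequality. -/
lemma norm_sq_sub_norm_sq_structurePolynomial [NeZero N]
    (ha : ∀ n : ℕ, 1 ≤ n → n < N → 0 < a n) (z : ℂ) :
    ‖(structurePolynomial N a b).eval z‖ ^ 2 -
      ‖(structurePolynomial N a b).eval (starRingEnd ℂ z)‖ ^ 2 =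
      4 * z.im * ∑ k : Fin N, ‖aeval z (phi a b (k + 1))‖ ^ 2 := by
  have h := structurePolynomial_mul_sharp_sub (b := b) ha z (starRingEnd ℂ z)
  rw [kernel_conj_self] at h
  simp only [sharp, Complex.conj_conj] at h
  rw [Complex.mul_conj', Complex.conj_mul', Complex.sub_conj] at h
  have h' : ((‖(structurePolynomial N a b).eval z‖ ^ 2 -
      ‖(structurePolynomial N a b).eval (starRingEnd ℂ z)‖ ^ 2 : ℝ) : ℂ) =
      ((4 * z.im * ∑ k : Fin N, ‖aeval z (phi a b (k + 1))‖ ^ 2 : ℝ) : ℂ) := by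
    push_cast at h ⊢
    rw [h]
    linear_combination (-4 * z.im * ∑ k : Fin N, (‖aeval z (phi a b (k + 1))‖ : ℂ) ^ 2) *
      Complex.I_mul_I
  exact_mod_cast h'

lemma isHermiteBiehler_structurePolynomial [NeZero N] (ha : ∀ n : ℕ, 1 ≤ n → n < N → 0 < a n) :
    IsHermiteBiehler fun z => (structurePolynomial N a b).eval z := by
  refine ⟨(structurePolynomial N a b).differentiable, fun z hz => ?_⟩
  have h := norm_sq_sub_norm_sq_structurePolynomial (b := b) ha z
  have h1 := one_le_sum_norm_sq (N := N) (a := a) (b := b) z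
  refine lt_of_pow_lt_pow_left₀ 2 (norm_nonneg _) ?_
  have : 0 < 4 * z.im * ∑ k : Fin N, ‖aeval z (phi a b (k + 1))‖ ^ 2 := by positivity
  linarith

lemma eval_structurePolynomial_ne_zero [NeZero N] (ha : ∀ n : ℕ, 1 ≤ n → n < N → 0 < a n)
    (z : ℂ) (hz : 0 ≤ z.im) : (structurePolynomial N a b).eval z ≠ 0 := by
  intro h0
  rcases hz.lt_or_eq with hz | hz
  · have := (isHermiteBiehler_structurePolynomial (b := b) ha).2 z hz
    simp only [h0, norm_zero] at this
    exact absurd this (norm_nonneg _).not_gt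
  · obtain ⟨x, rfl⟩ : ∃ x : ℝ, z = x := ⟨z.re, Complex.ext rfl (by simp [← hz])⟩
    have hs : sharp (fun z => (structurePolynomial N a b).eval z) x = 0 := by
      simp [sharp, h0]
    -- At a real zero `x` both `E` and `E#` vanish, so `(x - w) K(x,w) = 0` for all `w`. The factor
    -- is cancelled as a polynomial in `w`, since dividing at `w = x` is not possible, and then
    -- `K(x,x) = 0` contradicts `K(x,x) ≥ 1`.
    have hp : (C (x : ℂ) - X) * ∑ k : Fin N, C (aeval (x : ℂ) (phi a b (k + 1))) * phiC a b k
        = 0 := by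
      refine Polynomial.funext fun w => ?_
      have h := structurePolynomial_mul_sharp_sub (b := b) ha x w
      rw [hs, h0, zero_mul, zero_mul, sub_zero, eq_comm, mul_eq_zero] at h
      simpa [eval_finsetSum, kernel, eval_map_algebraMap] using h
    have hne : (C (x : ℂ) - X) ≠ 0 := by
      rw [← neg_sub]; exact neg_ne_zero.2 (X_sub_C_ne_zero _)
    have hk := congrArg (eval (x : ℂ)) ((mul_eq_zero.1 hp).resolve_left hne)
    have hk' : kernel N a b x x = 0 := by
      simpa [eval_finsetSum, kernel, eval_map_algebraMap] using hk
    rw [kernel_ofReal_self, Complex.ofReal_eq_zero] at hk'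
    linarith [one_le_normingConstant (N := N) (a := a) (b := b) x]

end HermiteBiehler

/-! ### Orthonormality for the spectral measure. -/

section Discrete

variable {N : ℕ} {a b : ℕ → ℝ}

/-- Roots are real because Christoffel–Darboux at `(z, conj z)` gives `(z - conj z) ∑ |φₖ(z)|² = 0`.
They are simple because the confluent identity would make the norming constant vanish at a double
root. -/
lemma card_roots_spectralPolynomial [NeZero N] (ha : ∀ n : ℕ, 1 ≤ n → n < N → 0 < a n) :
    (spectralPolynomial N a b).roots.toFinset.card = N := by
  obtain ⟨dQ, cQ⟩ := natDegree_spectralPolynomial (b := b) ha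
  have hQ : spectralPolynomial N a b ≠ 0 := fun h => cQ (by simp [h])
  have hsplit : (spectralPolynomial N a b).Splits := by
    refine Splits.of_splits_map (algebraMap ℝ ℂ) (IsAlgClosed.splits _) fun z hz => ?_
    have hz0 : aeval z (spectralPolynomial N a b) = 0 := by
      rw [← eval_map_algebraMap]
      exact isRoot_of_mem_roots hz
    have h := sub_mul_kernel (b := b) ha z (starRingEnd ℂ z)
    rw [aeval_conj_real, aeval_conj_real, hz0, map_zero, mul_zero, zero_mul, sub_zero,
      kernel_conj_self] at h
    have h1 := one_le_sum_norm_sq (N := N) (a := a) (b := b) z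
    rcases mul_eq_zero.1 h with h | h
    · exact ⟨z.re, Complex.conj_eq_iff_re.1 (sub_eq_zero.1 h).symm⟩
    · rw [Complex.ofReal_eq_zero] at h
      linarith
  have hnodup : (spectralPolynomial N a b).roots.Nodup := by
    rw [Multiset.nodup_iff_count_le_one]
    intro x
    rw [count_roots]
    by_contra! hx
    obtain ⟨h1, h2⟩ := (one_lt_rootMultiplicity_iff_isRoot hQ).1 hx
    have := normingConstant_eq (b := b) ha x
    rw [IsRoot.def] at h1 h2
    rw [h1, h2] at this
    linarith [one_le_normingConstant (N := N) (a := a) (b := b) x]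
  rw [Multiset.toFinset_card_of_nodup hnodup, ← hsplit.natDegree_eq_card_roots, dQ]

lemma integral_spectralMeasure [NeZero N] (f : ℝ → ℂ) :
    ∫ x, f x ∂(spectralMeasure N a b) =
      ∑ l ∈ (spectralPolynomial N a b).roots.toFinset, (normingConstant N a b l : ℂ)⁻¹ * f l := by
  rw [spectralMeasure, integral_finsetSum_measure]
  · refine Finset.sum_congr rfl fun l _ => ?_
    rw [integral_smul_measure, integral_dirac, ENNReal.toReal_ofReal]
    · simp
    · have := one_le_normingConstant (N := N) (a := a) (b := b) l
      positivity
  · intro l _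
    refine Integrable.smul_measure ?_ ENNReal.ofReal_ne_top
    exact integrable_dirac (by simp)

lemma kernel_roots_eq_zero [NeZero N] (ha : ∀ n : ℕ, 1 ≤ n → n < N → 0 < a n) {x y : ℝ}
    (hx : (spectralPolynomial N a b).IsRoot x) (hy : (spectralPolynomial N a b).IsRoot y)
    (hxy : x ≠ y) : kernel N a b x y = 0 := by
  have h := sub_mul_kernel (b := b) ha x y
  rw [aeval_ofReal_eq (spectralPolynomial N a b), aeval_ofReal_eq (spectralPolynomial N a b),
    hx.eq_zero, hy.eq_zero] at h
  simp only [Complex.ofReal_zero, zero_mul, mul_zero, sub_zero] at h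
  exact (mul_eq_zero.1 h).resolve_left (sub_ne_zero.2 (by exact_mod_cast hxy))

/-- The polynomials `φⱼ` are orthonormal for the spectral measure. -/
lemma integral_phi_mul_phi_spectralMeasure [NeZero N] (ha : ∀ n : ℕ, 1 ≤ n → n < N → 0 < a n)
    (j k : Fin N) :
    ∫ x : ℝ, aeval (x : ℂ) (phi a b (j + 1)) * aeval (x : ℂ) (phi a b (k + 1))
      ∂(spectralMeasure N a b) = if j = k then 1 else 0 := by
  set t := (spectralPolynomial N a b).roots.toFinset with ht
  have hroot : ∀ x ∈ t, (spectralPolynomial N a b).IsRoot x := fun x hx =>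
    isRoot_of_mem_roots (Multiset.mem_toFinset.1 hx)
  refine eq_ite_of_reproducing (b := b) ha (fun j k => ∫ x : ℝ, aeval (x : ℂ) (phi a b (j + 1)) *
    aeval (x : ℂ) (phi a b (k + 1)) ∂(spectralMeasure N a b)) (t.map ⟨Complex.ofReal, Complex.ofReal_injective⟩) ?_ ?_ j k
  · exact Or.inr ⟨_, subset_rfl, by
      rw [Finset.card_map, ht, card_roots_spectralPolynomial ha]⟩
  · intro j w hw
    obtain ⟨y, hy, rfl⟩ := Finset.mem_map.1 (Finset.mem_coe.1 hw)
    change ∑ k : Fin N, _ * aeval (y : ℂ) (phi a b (k + 1)) = aeval (y : ℂ) (phi a b (j + 1))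
    simp only [integral_spectralMeasure, Finset.sum_mul]
    rw [Finset.sum_comm]
    have : ∀ x ∈ t, ∑ k : Fin N, (normingConstant N a b x : ℂ)⁻¹ *
        (aeval (x : ℂ) (phi a b (j + 1)) * aeval (x : ℂ) (phi a b (k + 1))) *
          aeval (y : ℂ) (phi a b (k + 1)) =
        (normingConstant N a b x : ℂ)⁻¹ * aeval (x : ℂ) (phi a b (j + 1)) * kernel N a b x y := by
      intro x _
      rw [kernel, Finset.mul_sum]
      exact Finset.sum_congr rfl fun k _ => by ring
    -- The kernel vanishes between distinct roots; at `x = y` it equals the norming constant and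
    -- cancels the weight.
    rw [Finset.sum_congr rfl this, Finset.sum_eq_single_of_mem y hy]
    · have h1 : (normingConstant N a b y : ℂ) ≠ 0 := by
        have := one_le_normingConstant (N := N) (a := a) (b := b) y
        exact_mod_cast (by linarith : normingConstant N a b y ≠ 0)
      rw [kernel_ofReal_self]
      field_simp
    · intro x hx hxy
      rw [kernel_roots_eq_zero ha (hroot x hx) (hroot y hy) hxy, mul_zero]

/-- Parseval's identity for a weight for which the `φⱼ` are orthogonal with the same norm. -/
lemma integral_fourier_mul_conj_fourier {μ : Measure ℝ} {r : ℝ → ℂ} {κ : ℂ}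
    (hint : ∀ j k : Fin N, Integrable (fun x : ℝ => aeval (x : ℂ) (phi a b (j + 1)) *
      aeval (x : ℂ) (phi a b (k + 1)) * r x) μ)
    (horth : ∀ j k : Fin N, ∫ x : ℝ, aeval (x : ℂ) (phi a b (j + 1)) *
      aeval (x : ℂ) (phi a b (k + 1)) * r x ∂μ = if j = k then κ else 0)
    (c d : EuclideanSpace ℂ (Fin N)) :
    ∫ x : ℝ, fourier N a b c (x : ℂ) * starRingEnd ℂ (fourier N a b d (x : ℂ)) * r x ∂μ =
      κ * inner ℂ d c := by
  have h : ∀ x : ℝ, fourier N a b c (x : ℂ) * starRingEnd ℂ (fourier N a b d (x : ℂ)) * r x =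
      ∑ j : Fin N, ∑ k : Fin N, (c j * starRingEnd ℂ (d k)) *
        (aeval (x : ℂ) (phi a b (j + 1)) * aeval (x : ℂ) (phi a b (k + 1)) * r x) := by
    intro x
    rw [fourier, fourier, map_sum, Finset.sum_mul_sum, Finset.sum_mul]
    refine Finset.sum_congr rfl fun j _ => ?_
    rw [Finset.sum_mul]
    refine Finset.sum_congr rfl fun k _ => ?_
    rw [map_mul, ← aeval_conj_real, Complex.conj_ofReal]
    ring
  simp_rw [h]
  rw [integral_finsetSum _ fun j _ => integrable_finsetSum _ fun k _ =>
    (hint j k).const_mul _, PiLp.inner_apply, Finset.mul_sum]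
  refine Finset.sum_congr rfl fun j _ => ?_
  rw [integral_finsetSum _ fun k _ => (hint j k).const_mul _]
  simp only [integral_const_mul, horth, mul_ite, mul_zero, Finset.sum_ite_eq, Finset.mem_univ,
    if_true, RCLike.inner_apply]
  ring

/-- Parseval's identity for the spectral measure. -/
lemma inner_eq_integral_spectralMeasure [NeZero N] (ha : ∀ n : ℕ, 1 ≤ n → n < N → 0 < a n)
    (c d : EuclideanSpace ℂ (Fin N)) :
    inner ℂ d c = ∫ x : ℝ, fourier N a b c (x : ℂ) * starRingEnd ℂ (fourier N a b d (x : ℂ))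
      ∂(spectralMeasure N a b) := by
  have hint : ∀ f : ℝ → ℂ, Integrable f (spectralMeasure N a b) := fun f =>
    integrable_finsetSum_measure.2 fun l _ =>
      (integrable_dirac (by simp)).smul_measure ENNReal.ofReal_ne_top
  simpa using (integral_fourier_mul_conj_fourier (r := fun _ => 1) (κ := 1) (fun _ _ => hint _)
    (fun j k => by simpa using integral_phi_mul_phi_spectralMeasure ha j k) c d).symm

end Discrete

/-! ### The equation `u'' = A u + f e`: Duhamel's formula and uniqueness. -/

section SecondOrder

variable {V : Type*} [NormedAddCommGroup V] [NormedSpace ℂ V]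

/-- The first order system `(u, v)' = (v, A u)`. -/
def firstOrderSystem (A : V →L[ℂ] V) : V × V →L[ℂ] V × V :=
  (ContinuousLinearMap.snd ℂ V V).prod (A.comp (ContinuousLinearMap.fst ℂ V V))

/-- The solution of `p'' = A p`, `p(0) = 0`, `p'(0) = e`. -/
lemma exists_impulse_response [CompleteSpace V] (A : V →L[ℂ] V) (e : V) :
    ∃ p q : ℝ → V, (∀ t, HasDerivAt p (q t) t) ∧ (∀ t, HasDerivAt q (A (p t)) t) ∧
      p 0 = 0 ∧ q 0 = e := by
  set L := firstOrderSystem A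
  have hY : ∀ t : ℝ, HasDerivAt (fun t : ℝ => NormedSpace.exp (t • L) ((0, e) : V × V))
      (L (NormedSpace.exp (t • L) ((0, e) : V × V))) t := fun t =>
    ((ContinuousLinearMap.apply ℂ (V × V) ((0, e) : V × V)).restrictScalars
      ℝ).hasFDerivAt.comp_hasDerivAt t (hasDerivAt_exp_smul_const' L t)
  refine ⟨fun t => (NormedSpace.exp (t • L) ((0, e) : V × V)).1,
    fun t => (NormedSpace.exp (t • L) ((0, e) : V × V)).2, fun t => ?_, fun t => ?_, ?_, ?_⟩
  · exact (hY t).fst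
  · exact (hY t).snd
  · simp
  · simp

lemma integrable_triangle {k : ℝ → V} (hk : Continuous k) {f : ℝ → ℂ} {t : ℝ}
    (hf : IntegrableOn f (Set.Ioc 0 t)) :
    Integrable (fun x : ℝ × ℝ => Set.indicator {x : ℝ × ℝ | x.2 ≤ x.1}
      (fun x => f x.2 • k (x.1 - x.2)) x)
      ((volume.restrict (Set.Ioc 0 t)).prod (volume.restrict (Set.Ioc 0 t))) := by
  refine Integrable.indicator ?_ (measurableSet_le measurable_snd measurable_fst)
  obtain ⟨C, hC⟩ := (isCompact_Icc (a := -t) (b := t)).exists_bound_of_continuousOn hk.continuousOn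
  refine (Integrable.comp_snd hf _).smul_bdd (C := C)
    (by exact (hk.comp (continuous_fst.sub continuous_snd)).aestronglyMeasurable) ?_
  rw [Measure.prod_restrict]
  refine ae_restrict_of_forall_mem (measurableSet_Ioc.prod measurableSet_Ioc) fun x hx => ?_
  obtain ⟨⟨h1, h2⟩, h3, h4⟩ := hx
  exact hC _ ⟨by linarith, by linarith⟩

lemma integral_indicator_triangle {g : ℝ → V} {t τ : ℝ} (hτ : τ ∈ Set.Ioc 0 t) :
    ∫ s in Set.Ioc 0 t, Set.indicator {s | s ≤ τ} g s = ∫ s in (0 : ℝ)..τ, g s := by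
  rw [intervalIntegral.integral_of_le hτ.1.le, ← integral_indicator measurableSet_Ioc,
    ← integral_indicator measurableSet_Ioc]
  congr 1
  ext s
  simp only [Set.indicator_apply, Set.mem_Ioc, Set.mem_ofPred_eq]
  have := hτ.2
  split_ifs <;> first | rfl | grind

lemma intervalIntegrable_convolution {k : ℝ → V} (hk : Continuous k) {f : ℝ → ℂ} {t : ℝ}
    (ht : 0 ≤ t) (hf : IntegrableOn f (Set.Ioc 0 t)) :
    IntervalIntegrable (fun τ => ∫ s in (0 : ℝ)..τ, f s • k (τ - s)) volume 0 t := by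
  rw [intervalIntegrable_iff_integrableOn_Ioc_of_le ht]
  refine ((integrable_triangle hk hf).integral_prod_left).congr ?_
  refine ae_restrict_of_forall_mem measurableSet_Ioc fun τ hτ => ?_
  exact integral_indicator_triangle (g := fun s => f s • k (τ - s)) hτ

/-- Integrating a convolution amounts to integrating the kernel. -/
lemma integral_convolution {k : ℝ → V} (hk : Continuous k) {f : ℝ → ℂ} {t : ℝ}
    (ht : 0 ≤ t) (hf : IntegrableOn f (Set.Ioc 0 t)) :
    ∫ τ in (0 : ℝ)..t, ∫ s in (0 : ℝ)..τ, f s • k (τ - s) =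
      ∫ s in (0 : ℝ)..t, f s • ∫ r in (0 : ℝ)..(t - s), k r := by
  rw [intervalIntegral.integral_of_le ht, intervalIntegral.integral_of_le ht,
    ← setIntegral_congr_fun measurableSet_Ioc fun τ hτ =>
      integral_indicator_triangle (g := fun s => f s • k (τ - s)) hτ]
  refine (integral_integral_swap (integrable_triangle hk hf)).trans ?_
  refine setIntegral_congr_fun measurableSet_Ioc fun s hs => ?_
  have hshift : ∫ r in (0 : ℝ)..(t - s), k r = ∫ τ in s..t, k (τ - s) := by
    rw [intervalIntegral.integral_comp_sub_right, sub_self]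
  rw [hshift,
    ← intervalIntegral.integral_smul, intervalIntegral.integral_of_le hs.2,
    ← integral_indicator measurableSet_Ioc, ← integral_indicator measurableSet_Ioc]
  refine integral_congr_ae ?_
  -- The triangle contains `τ = s`, the half-open interval `(s, t]` does not; one point is null.
  filter_upwards [compl_mem_ae_iff.2 (measure_singleton s)] with τ hτ
  simp only [Set.indicator_apply, Set.mem_Ioc, Set.mem_ofPred_eq, Set.mem_compl_iff,
    Set.mem_singleton_iff] at hτ ⊢
  have := hs.1
  split_ifs <;> first | rfl | grind

/-- Duhamel's principle: `u = f * p` and `v = f * q`. The two integral equations follow by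
convolving `p = ∫ q` and `q = e + ∫ A p` with `f` and applying Fubini, so `f` need only be
integrable. -/
lemma exists_solution_integrated [CompleteSpace V] (A : V →L[ℂ] V) {e : V} {p q : ℝ → V}
    (hp : ∀ t, HasDerivAt p (q t) t) (hq : ∀ t, HasDerivAt q (A (p t)) t) (hp0 : p 0 = 0)
    (hq0 : q 0 = e) {T : ℝ} (hT : 0 < T) {f : ℝ → ℂ} (hf : IntegrableOn f (Set.Ioc 0 T)) :
    ∃ u v : ℝ → V, ContinuousOn u (Set.Icc 0 T) ∧ ContinuousOn v (Set.Icc 0 T) ∧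
      (∀ t ∈ Set.Icc 0 T, u t = ∫ s in (0 : ℝ)..t, v s) ∧
      (∀ t ∈ Set.Icc 0 T, v t = ∫ s in (0 : ℝ)..t, (A (u s) + f s • e)) ∧
      u T = ∫ s in (0 : ℝ)..T, f s • p (T - s) := by
  have cp : Continuous p := continuous_iff_continuousAt.2 fun t => (hp t).continuousAt
  have cq : Continuous q := continuous_iff_continuousAt.2 fun t => (hq t).continuousAt
  have cA : Continuous fun t => A (p t) := A.continuous.comp cp
  have ip : ∀ t, p t = ∫ r in (0 : ℝ)..t, q r := fun t => by
    rw [intervalIntegral.integral_eq_sub_of_hasDerivAt (fun x _ => hp x)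
      (cq.intervalIntegrable _ _), hp0, sub_zero]
  have iq : ∀ t, q t = e + ∫ r in (0 : ℝ)..t, A (p r) := fun t => by
    rw [intervalIntegral.integral_eq_sub_of_hasDerivAt (fun x _ => hq x)
      (cA.intervalIntegrable _ _), hq0, add_sub_cancel]
  have hft : ∀ t ∈ Set.Icc 0 T, IntegrableOn f (Set.Ioc 0 t) := fun t ht =>
    hf.mono_set (Set.Ioc_subset_Ioc_right ht.2)
  have hfp : ∀ t ∈ Set.Icc 0 T, ∀ k : ℝ → V, Continuous k →
      IntervalIntegrable (fun s => f s • k (t - s)) volume 0 t := fun t ht k hk =>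
    ((intervalIntegrable_iff_integrableOn_Ioc_of_le ht.1).2 (hft t ht)).smul_continuousOn
      (hk.comp (continuous_const.sub continuous_id)).continuousOn
  set u : ℝ → V := fun t => ∫ s in (0 : ℝ)..t, f s • p (t - s) with hu
  set v : ℝ → V := fun t => ∫ s in (0 : ℝ)..t, f s • q (t - s) with hv
  have iu : ∀ t ∈ Set.Icc 0 T, u t = ∫ s in (0 : ℝ)..t, v s := fun t ht => by
    simp only [hv]
    rw [integral_convolution cq ht.1 (hft t ht)]
    simp only [hu, ← ip]
  have hAu : ∀ s ∈ Set.Icc 0 T, A (u s) = ∫ r in (0 : ℝ)..s, f r • A (p (s - r)) := fun s hs => by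
    simp only [hu]
    rw [← A.intervalIntegral_comp_comm (hfp s hs p cp)]
    simp only [map_smul]
  have hfe : IntervalIntegrable (fun s => f s • e) volume 0 T :=
    IntervalIntegrable.smul_continuousOn
      ((intervalIntegrable_iff_integrableOn_Ioc_of_le hT.le).2 hf) continuousOn_const
  have hAui : IntervalIntegrable (fun s => A (u s)) volume 0 T := by
    refine (intervalIntegrable_convolution cA hT.le hf).congr fun s hs => (hAu s ?_).symm
    rw [Set.uIoc_of_le hT.le] at hs
    exact Set.Ioc_subset_Icc_self hs
  have iv : ∀ t ∈ Set.Icc 0 T, v t = ∫ s in (0 : ℝ)..t, (A (u s) + f s • e) := fun t ht => by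
    have hsub : Set.uIcc 0 t ⊆ Set.uIcc 0 T := by
      rw [Set.uIcc_of_le ht.1, Set.uIcc_of_le hT.le]
      exact Set.Icc_subset_Icc_right ht.2
    rw [intervalIntegral.integral_add (hAui.mono_set hsub) (hfe.mono_set hsub)]
    rw [intervalIntegral.integral_congr fun s hs => hAu s ?_,
      integral_convolution cA ht.1 (hft t ht), ← intervalIntegral.integral_add]
    · simp only [hv, iq, smul_add]
      exact intervalIntegral.integral_congr fun s _ => add_comm _ _
    · refine hfp t ht (fun x => ∫ r in (0 : ℝ)..x, A (p r)) ?_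
      exact intervalIntegral.continuous_primitive (fun _ _ => cA.intervalIntegrable _ _) 0
    · exact hfe.mono_set hsub
    · rw [← Set.uIcc_of_le hT.le]
      exact hsub hs
  have cont : ∀ (g G : ℝ → V), IntervalIntegrable g volume 0 T →
      (∀ t ∈ Set.Icc 0 T, G t = ∫ s in (0 : ℝ)..t, g s) → ContinuousOn G (Set.Icc 0 T) := by
    intro g G hg hG
    have := intervalIntegral.continuousOn_primitive_interval' hg
      (by rw [Set.uIcc_of_le hT.le]; exact ⟨le_rfl, hT.le⟩)
    rw [Set.uIcc_of_le hT.le] at this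
    exact this.congr hG
  exact ⟨u, v, cont v u (intervalIntegrable_convolution cq hT.le hf) iu,
    cont _ v (hAui.add hfe) iv, iu, iv, rfl⟩

lemma eq_zero_of_integrated [CompleteSpace V] (A : V →L[ℂ] V) {T : ℝ} (hT : 0 < T) {u v : ℝ → V}
    (hu : ContinuousOn u (Set.Icc 0 T)) (hv : ContinuousOn v (Set.Icc 0 T))
    (iu : ∀ t ∈ Set.Icc 0 T, u t = ∫ s in (0 : ℝ)..t, v s)
    (iv : ∀ t ∈ Set.Icc 0 T, v t = ∫ s in (0 : ℝ)..t, A (u s)) : u T = 0 := by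
  -- Extension by the end values gives integrands continuous on all of `ℝ`, so the primitives are
  -- differentiable everywhere and uniqueness for a Lipschitz ODE applies.
  set u' : ℝ → V := Set.IccExtend hT.le ((Set.Icc 0 T).domRestrict u) with hu'
  set v' : ℝ → V := Set.IccExtend hT.le ((Set.Icc 0 T).domRestrict v) with hv'
  have cu : Continuous u' := (continuousOn_iff_continuous_domRestrict.1 hu).Icc_extend'
  have cv : Continuous v' := (continuousOn_iff_continuous_domRestrict.1 hv).Icc_extend'
  have cAu : Continuous fun s => A (u' s) := A.continuous.comp cu
  have eu : ∀ t ∈ Set.Icc 0 T, u' t = u t := fun t ht => Set.IccExtend_of_mem _ _ ht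
  have ev : ∀ t ∈ Set.Icc 0 T, v' t = v t := fun t ht => Set.IccExtend_of_mem _ _ ht
  have iu' : ∀ t ∈ Set.Icc 0 T, ∫ s in (0 : ℝ)..t, v' s = u' t := fun t ht => by
    rw [eu t ht, iu t ht]
    refine intervalIntegral.integral_congr fun s hs => ev s ?_
    rw [Set.uIcc_of_le ht.1] at hs
    exact ⟨hs.1, hs.2.trans ht.2⟩
  have iv' : ∀ t ∈ Set.Icc 0 T, ∫ s in (0 : ℝ)..t, A (u' s) = v' t := fun t ht => by
    rw [ev t ht, iv t ht]
    refine intervalIntegral.integral_congr fun s hs => by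
      rw [Set.uIcc_of_le ht.1] at hs
      simp only [eu s ⟨hs.1, hs.2.trans ht.2⟩]
  have hd : ∀ t, HasDerivAt (fun t => (∫ s in (0 : ℝ)..t, v' s, ∫ s in (0 : ℝ)..t, A (u' s)))
      (v' t, A (u' t)) t := fun t =>
    (cv.integral_hasStrictDerivAt 0 t).hasDerivAt.prodMk
      (cAu.integral_hasStrictDerivAt 0 t).hasDerivAt
  have key := ODE_solution_unique (v := fun _ => firstOrderSystem A)
    (K := ‖firstOrderSystem A‖₊) (a := 0) (b := T)
    (f := fun t => (∫ s in (0 : ℝ)..t, v' s, ∫ s in (0 : ℝ)..t, A (u' s))) (g := fun _ => 0)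
    (fun _ => (firstOrderSystem A).lipschitz)
    (fun t _ => (hd t).continuousAt.continuousWithinAt)
    (fun t ht => by
      have ht' : t ∈ Set.Icc 0 T := Set.Ico_subset_Icc_self ht
      convert! (hd t).hasDerivWithinAt using 1
      simp [firstOrderSystem, iu' t ht', iv' t ht'])
    continuousOn_const
    (fun t _ => by simpa using hasDerivWithinAt_const t _ (0 : V × V))
    (by simp)
  have h1 := congrArg Prod.fst (key (Set.right_mem_Icc.2 hT.le))
  simp only [iu' T (Set.right_mem_Icc.2 hT.le), eu T (Set.right_mem_Icc.2 hT.le)] at h1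
  exact h1

end SecondOrder

/-! ### The control operator and its surjectivity. -/

section Control

variable {N : ℕ} {a b : ℕ → ℝ} {T : ℝ}

/-- The Jacobi matrix as a continuous operator on `ℂ^N`. -/
def jacobiOperator (N : ℕ) (a b : ℕ → ℝ) :
    EuclideanSpace ℂ (Fin N) →L[ℂ] EuclideanSpace ℂ (Fin N) :=
  LinearMap.toContinuousLinearMap
    (Matrix.toEuclideanLin ((jacobiMatrix N a b).map Complex.ofReal))

lemma inner_jacobiOperator (x y : EuclideanSpace ℂ (Fin N)) :
    inner ℂ (jacobiOperator N a b x) y = inner ℂ x (jacobiOperator N a b y) := by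
  refine Matrix.isSymmetric_toEuclideanLin_iff.2 ?_ x y
  ext i j
  simp only [Matrix.conjTranspose_apply, Matrix.map_apply, jacobiMatrix, Matrix.of_apply]
  rw [RCLike.star_def, Complex.conj_ofReal]
  congr 1
  split_ifs <;> first | rfl | grind

lemma jacobiOperator_apply (x : EuclideanSpace ℂ (Fin N)) (i : Fin N) :
    jacobiOperator N a b x i = ∑ j, (jacobiMatrix N a b i j : ℂ) * x j := by
  simp [jacobiOperator, Matrix.toLpLin_apply, Matrix.mulVec, dotProduct]

/-- The first basis vector is cyclic for the Jacobi operator. -/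
lemma eq_zero_of_invariant [NeZero N] (ha : ∀ n : ℕ, 1 ≤ n → n < N → 0 < a n)
    {Y : Set (EuclideanSpace ℂ (Fin N))} (hY : ∀ y ∈ Y, jacobiOperator N a b y ∈ Y)
    (hY0 : ∀ y ∈ Y, y 0 = 0) : ∀ y ∈ Y, y = 0 := by
  -- If entries `0, …, n` vanish for every vector of `Y`, then entry `n` of `A y`, which is also
  -- zero, reduces to `a (n + 1)` times entry `n + 1` of `y`.
  have key : ∀ n : ℕ, ∀ y ∈ Y, ∀ k : Fin N, (k : ℕ) ≤ n → y k = 0 := by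
    intro n
    induction n with
    | zero =>
      intro y hy k hk
      rw [show k = 0 from Fin.ext (by simpa using hk)]
      exact hY0 y hy
    | succ n ih =>
      intro y hy k hk
      rcases Nat.lt_or_ge n k with h | h
      · have hkn : (k : ℕ) = n + 1 := le_antisymm hk h
        have hn : n < N := by have := k.2; omega
        have h1 := ih _ (hY y hy) ⟨n, hn⟩ le_rfl
        rw [jacobiOperator_apply, Finset.sum_eq_single_of_mem k (Finset.mem_univ _)] at h1
        · refine (mul_eq_zero.1 h1).resolve_left ?_
          have hne : (⟨n, hn⟩ : Fin N) ≠ k := fun h => by simp [← h] at hkn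
          rw [jacobiMatrix, Matrix.of_apply, if_neg hne, if_pos hkn.symm]
          exact Complex.ofReal_ne_zero.2 (ha (n + 1) (by omega) (hkn ▸ k.2)).ne'
        · intro j _ hj
          rcases Nat.lt_or_ge n j with hjn | hjn
          · have : (j : ℕ) ≠ k := fun h => hj (Fin.ext h)
            rw [jacobiMatrix, Matrix.of_apply, if_neg (fun h => by simp [← h] at hjn),
              if_neg (by simp only; omega), if_neg (by simp only; omega)]
            simp
          · rw [ih y hy j hjn, mul_zero]
      · exact ih y hy k h
  intro y hy
  ext k
  exact key N y hy k k.2.le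

lemma isSolution_iff [NeZero N] {f : Control T} {u : ℝ → EuclideanSpace ℂ (Fin N)} :
    IsSolution N a b T f u ↔ ∃ v : ℝ → EuclideanSpace ℂ (Fin N),
      ContinuousOn u (Set.Icc 0 T) ∧ ContinuousOn v (Set.Icc 0 T) ∧
      (∀ t ∈ Set.Icc 0 T, u t = ∫ s in (0 : ℝ)..t, v s) ∧
      (∀ t ∈ Set.Icc 0 T, v t = ∫ s in (0 : ℝ)..t,
        (jacobiOperator N a b (u s) + f s • EuclideanSpace.single (0 : Fin N) (1 : ℂ))) := by
  have h : ∀ c : ℂ, c • EuclideanSpace.single (0 : Fin N) (1 : ℂ) = EuclideanSpace.single 0 c :=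
    fun c => by ext i; simp
  simp only [h]
  rfl

lemma integrableOn_control (f : Control T) : IntegrableOn f (Set.Ioc 0 T) := by
  rw [integrableOn_Ioc_iff_integrableOn_Ioo]
  exact (Lp.memLp f).integrable (by norm_num)

/-- The control cancels in the difference of two solutions, which solves the homogeneous problem. -/
lemma IsSolution.final_eq [NeZero N] (hT : 0 < T) {f : Control T} {u u' : ℝ → EuclideanSpace ℂ (Fin N)}
    (hu : IsSolution N a b T f u) (hu' : IsSolution N a b T f u') : u T = u' T := by
  obtain ⟨v, cu, cv, iu, iv⟩ := isSolution_iff.1 hu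
  obtain ⟨v', cu', cv', iu', iv'⟩ := isSolution_iff.1 hu'
  have hsub : ∀ t ∈ Set.Icc 0 T, Set.uIcc 0 t ⊆ Set.Icc 0 T := fun t ht => by
    rw [Set.uIcc_of_le ht.1]
    exact Set.Icc_subset_Icc_right ht.2
  have hfe : ∀ t ∈ Set.Icc 0 T, IntervalIntegrable
      (fun s => f s • EuclideanSpace.single (0 : Fin N) (1 : ℂ)) volume 0 t := fun t ht =>
    IntervalIntegrable.smul_continuousOn ((intervalIntegrable_iff_integrableOn_Ioc_of_le ht.1).2
      ((integrableOn_control f).mono_set (Set.Ioc_subset_Ioc_right ht.2))) continuousOn_const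
  have hAu : ∀ w : ℝ → EuclideanSpace ℂ (Fin N), ContinuousOn w (Set.Icc 0 T) →
      ∀ t ∈ Set.Icc 0 T, IntervalIntegrable (fun s => jacobiOperator N a b (w s)) volume 0 t :=
    fun w hw t ht => ContinuousOn.intervalIntegrable
      ((jacobiOperator N a b).continuous.comp_continuousOn (hw.mono (hsub t ht)))
  refine sub_eq_zero.1 (eq_zero_of_integrated (jacobiOperator N a b) hT
    (u := fun t => u t - u' t) (v := fun t => v t - v' t) (cu.sub cu') (cv.sub cv') ?_ ?_)
  · intro t ht
    rw [intervalIntegral.integral_sub ((cv.mono (hsub t ht)).intervalIntegrable)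
      ((cv'.mono (hsub t ht)).intervalIntegrable), iu t ht, iu' t ht]
  · intro t ht
    rw [iv t ht, iv' t ht, ← intervalIntegral.integral_sub ((hAu u cu t ht).add (hfe t ht))
      ((hAu u' cu' t ht).add (hfe t ht))]
    simp only [add_sub_add_right_eq_sub, map_sub]

/-- The control operator exists, and every state is reachable. -/
theorem exists_controlOperator_surjective [NeZero N]
    (ha : ∀ n : ℕ, 1 ≤ n → n < N → 0 < a n) (hT : 0 < T) :
    ∃ W : Control T →L[ℂ] EuclideanSpace ℂ (Fin N),
      IsControlOperator N a b T W ∧ Function.Surjective W := by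
  obtain ⟨p, q, hp, hq, hp0, hq0⟩ := exists_impulse_response (jacobiOperator N a b)
    (EuclideanSpace.single (0 : Fin N) (1 : ℂ))
  have cp : Continuous p := continuous_iff_continuousAt.2 fun t => (hp t).continuousAt
  have cq : Continuous q := continuous_iff_continuousAt.2 fun t => (hq t).continuousAt
  have ck : ∀ y, Continuous fun s : ℝ => inner ℂ (p (T - s)) y := fun y =>
    (cp.comp (continuous_const.sub continuous_id)).inner continuous_const
  have mk : ∀ y, MemLp (fun s : ℝ => inner ℂ (p (T - s)) y) 2
      (volume.restrict (Set.Ioo (0 : ℝ) T)) := fun y => by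
    obtain ⟨C, hC⟩ := (isCompact_Icc (a := (0 : ℝ)) (b := T)).exists_bound_of_continuousOn
      (ck y).continuousOn
    exact MemLp.of_bound (ck y).aestronglyMeasurable C
      (ae_restrict_of_forall_mem measurableSet_Ioo fun s hs => hC s (Set.Ioo_subset_Icc_self hs))
  -- The adjoint `y ↦ ⟨p(T - ·), y⟩` is built first. It is continuous because its domain is
  -- finite-dimensional, so `W`, defined as the adjoint of `κ`, is bounded at no cost.
  let κ : EuclideanSpace ℂ (Fin N) →ₗ[ℂ] Control T :=
    { toFun := fun y => (mk y).toLp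
      map_add' := fun x y => by
        rw [← MemLp.toLp_add]
        congr 1
        ext s
        simp
      map_smul' := fun c y => by
        rw [RingHom.id_apply, ← MemLp.toLp_const_smul]
        congr 1
        ext s
        simp }
  have hint : ∀ f : Control T, IntegrableOn (fun s => f s • p (T - s)) (Set.Ioo 0 T) := fun f => by
    rw [← integrableOn_Ioc_iff_integrableOn_Ioo,
      ← intervalIntegrable_iff_integrableOn_Ioc_of_le hT.le]
    exact IntervalIntegrable.smul_continuousOn ((intervalIntegrable_iff_integrableOn_Ioc_of_le
      hT.le).2 (integrableOn_control f)) (cp.comp (continuous_const.sub continuous_id)).continuousOn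
  let W := ContinuousLinearMap.adjoint (LinearMap.toContinuousLinearMap κ)
  have hW : ∀ f, W f = ∫ s in (0 : ℝ)..T, f s • p (T - s) := fun f => by
    refine ext_inner_left ℂ fun y => ?_
    rw [ContinuousLinearMap.adjoint_inner_right, LinearMap.coe_toContinuousLinearMap', L2.inner_def,
      intervalIntegral.integral_of_le hT.le, integral_Ioc_eq_integral_Ioo,
      ← integral_inner (hint f)]
    refine integral_congr_ae ?_
    filter_upwards [(mk y).coeFn_toLp] with s hs
    change inner ℂ ((((mk y).toLp _ : Control T) : ℝ → ℂ) s) (f s) = _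
    rw [hs, inner_smul_right, RCLike.inner_apply, inner_conj_symm]
  have hsol : ∀ f : Control T, ∃ u, IsSolution N a b T f u ∧ W f = u T := fun f => by
    obtain ⟨u, v, cu, cv, iu, iv, huT⟩ := exists_solution_integrated (jacobiOperator N a b) hp hq
      hp0 hq0 hT (integrableOn_control f)
    exact ⟨u, isSolution_iff.2 ⟨v, cu, cv, iu, iv⟩, by rw [hW, huT]⟩
  refine ⟨W, fun f => ?_, ?_⟩
  · obtain ⟨u, hu, hWu⟩ := hsol f
    exact ⟨⟨u, hu⟩, fun u' hu' => hWu.trans (hu.final_eq hT hu')⟩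
  have hκ : ∀ y, κ y = 0 → y = 0 := by
    let Y : Set (EuclideanSpace ℂ (Fin N)) := {y | ∀ t ∈ Set.Ioo 0 T, inner ℂ (p t) y = (0 : ℂ)}
    have hderiv : ∀ (g g' : ℝ → EuclideanSpace ℂ (Fin N)), (∀ t, HasDerivAt g (g' t) t) → ∀ y,
        (∀ t ∈ Set.Ioo 0 T, inner ℂ (g t) y = (0 : ℂ)) →
          ∀ t ∈ Set.Ioo 0 T, inner ℂ (g' t) y = (0 : ℂ) := by
      intro g g' hg y h t ht
      have h1 : HasDerivAt (fun t => inner ℂ (g t) y) (inner ℂ (g' t) y) t := by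
        simpa using (hg t).inner ℂ (hasDerivAt_const t y)
      refine h1.unique ((hasDerivAt_const t (0 : ℂ)).congr_of_eventuallyEq ?_)
      filter_upwards [Ioo_mem_nhds ht.1 ht.2] with s hs using h s hs
    have hYq : ∀ y ∈ Y, ∀ t ∈ Set.Ioo 0 T, inner ℂ (q t) y = (0 : ℂ) := fun y hy =>
      hderiv p q hp y hy
    intro y hy
    -- Invariance: `⟨p, A y⟩ = ⟨A p, y⟩` is the second derivative of `⟨p, y⟩ = 0`. First entry: `⟨q,
    -- y⟩ = 0` on `(0,T)` extends by continuity to `t = 0`, where `q(0) = e₁`.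
    refine eq_zero_of_invariant (b := b) (Y := Y) ha (fun y hy t ht => ?_) (fun y hy => ?_) y ?_
    · rw [← inner_jacobiOperator]
      exact hderiv q _ hq y (hYq y hy) t ht
    · have hc : Continuous fun t => inner ℂ (q t) y := cq.inner continuous_const
      have h0 : (0 : ℝ) ∈ closure (Set.Ioo 0 T) := by
        rw [closure_Ioo hT.ne]
        exact ⟨le_rfl, hT.le⟩
      have h1 : inner ℂ (q 0) y = (0 : ℂ) :=
        (isClosed_eq hc continuous_const).closure_subset_iff.2
          (fun t ht => hYq y hy t ht) h0
      rw [hq0] at h1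
      simpa [EuclideanSpace.inner_single_left] using h1
    · have hae : (fun s : ℝ => inner ℂ (p (T - s)) y) =ᵐ[volume.restrict (Set.Ioo 0 T)]
          fun _ => (0 : ℂ) :=
        (mk y).coeFn_toLp.symm.trans ((Lp.ext_iff.1 hy).trans (Lp.coeFn_zero _ _ _))
      -- Vanishing in `L₂` is only almost everywhere; continuity upgrades it to every point of the
      -- open interval.
      have heq := Measure.eqOn_open_of_ae_eq hae isOpen_Ioo (ck y).continuousOn continuousOn_const
      intro t ht
      have := heq (show T - t ∈ Set.Ioo 0 T from ⟨by linarith [ht.2], by linarith [ht.1]⟩)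
      simpa using this
  have hrange : LinearMap.range (W : Control T →ₗ[ℂ] EuclideanSpace ℂ (Fin N)) = ⊤ := by
    rw [← Submodule.orthogonal_eq_bot_iff, Submodule.eq_bot_iff]
    intro y hy
    refine hκ y (ext_inner_right ℂ fun f => ?_)
    have h := (Submodule.mem_orthogonal' _ y).1 hy (W f) ⟨f, rfl⟩
    rw [ContinuousLinearMap.adjoint_inner_right] at h
    rw [inner_zero_left]
    exact h
  exact LinearMap.range_eq_top.1 hrange

end Control

/-! ### Rational functions on the upper half-plane: decay and contour integrals. -/

section HalfPlane

/-- In the closed upper half-plane `‖z + i‖` serves as the size of `z`: it dominates both `‖z‖` and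
1, so polynomial bounds need no separate treatment near the origin. -/
lemma norm_le_norm_add_I {z : ℂ} (hz : 0 ≤ z.im) : ‖z‖ ≤ ‖z + Complex.I‖ := by
  rw [← sq_le_sq₀ (norm_nonneg _) (norm_nonneg _), Complex.sq_norm, Complex.sq_norm,
    Complex.normSq_apply, Complex.normSq_apply]
  simp only [Complex.add_re, Complex.I_re, add_zero, Complex.add_im, Complex.I_im]
  nlinarith

lemma one_le_norm_add_I {z : ℂ} (hz : 0 ≤ z.im) : 1 ≤ ‖z + Complex.I‖ := by
  refine le_trans ?_ (Complex.abs_im_le_norm _)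
  rw [Complex.add_im, Complex.I_im, abs_of_nonneg (by linarith)]
  linarith

lemma one_add_sq_le_norm_add_I_sq (x : ℝ) {y : ℝ} (hy : 0 ≤ y) :
    1 + x ^ 2 ≤ ‖(x : ℂ) + y * Complex.I + Complex.I‖ ^ 2 := by
  rw [Complex.sq_norm, Complex.normSq_apply]
  simp only [Complex.add_re, Complex.ofReal_re, Complex.mul_re, Complex.I_re, mul_zero,
    Complex.ofReal_im, Complex.I_im, mul_one, sub_self, add_zero, Complex.add_im, Complex.mul_im,
    zero_add]
  nlinarith

/-- For one factor, `‖z + i‖ ≤ ‖z - w‖ + ‖w + i‖`, and the last term is at most a multiple of `‖z -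
w‖` because `‖z - w‖ ≥ -Im w > 0`. -/
lemma exists_lower_bound_prod (s : Multiset ℂ) (hs : ∀ w ∈ s, w.im < 0) :
    ∃ c : ℝ, 0 < c ∧ ∀ z : ℂ, 0 ≤ z.im →
      c * ‖z + Complex.I‖ ^ s.card ≤ ‖(s.map fun w => z - w).prod‖ := by
  induction s using Multiset.induction with
  | empty => exact ⟨1, one_pos, by simp⟩
  | cons w s ih =>
    obtain ⟨c, hc, h⟩ := ih fun v hv => hs v (Multiset.mem_cons_of_mem hv)
    have hw := hs w (Multiset.mem_cons_self w s)
    have hD : 0 < 1 + ‖w + Complex.I‖ / (-w.im) := by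
      have : 0 < -w.im := by linarith
      positivity
    refine ⟨(1 + ‖w + Complex.I‖ / (-w.im))⁻¹ * c, by positivity, fun z hz => ?_⟩
    have h1 : -w.im ≤ ‖z - w‖ := by
      refine le_trans ?_ (Complex.abs_im_le_norm _)
      rw [Complex.sub_im]
      exact (by linarith : -w.im ≤ z.im - w.im).trans (le_abs_self _)
    have h2 : ‖z + Complex.I‖ ≤ ‖z - w‖ + ‖w + Complex.I‖ := by
      refine le_trans (le_of_eq ?_) (norm_add_le _ _)
      congr 1; ring
    have h3 : ‖w + Complex.I‖ ≤ ‖w + Complex.I‖ / (-w.im) * ‖z - w‖ := by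
      rw [div_mul_eq_mul_div, le_div_iff₀ (by linarith)]
      exact mul_le_mul_of_nonneg_left h1 (norm_nonneg _)
    have h4 : (1 + ‖w + Complex.I‖ / (-w.im))⁻¹ * ‖z + Complex.I‖ ≤ ‖z - w‖ := by
      rw [inv_mul_le_iff₀ hD]
      linarith
    rw [Multiset.map_cons, Multiset.prod_cons, norm_mul, Multiset.card_cons, pow_succ]
    calc _ = ((1 + ‖w + Complex.I‖ / (-w.im))⁻¹ * ‖z + Complex.I‖) *
          (c * ‖z + Complex.I‖ ^ s.card) := by ring
      _ ≤ _ := mul_le_mul h4 (h z hz) (by positivity) (norm_nonneg _)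

/-- A polynomial without zeros in the closed upper half-plane grows there like its leading term. -/
lemma exists_lower_bound {q : ℂ[X]} (hq : ∀ z : ℂ, 0 ≤ z.im → q.eval z ≠ 0) :
    ∃ c : ℝ, 0 < c ∧ ∀ z : ℂ, 0 ≤ z.im → c * ‖z + Complex.I‖ ^ q.natDegree ≤ ‖q.eval z‖ := by
  have hs : q.Splits := IsAlgClosed.splits q
  have hq0 : q ≠ 0 := fun h => hq 0 le_rfl (by simp [h])
  obtain ⟨c, hc, h⟩ := exists_lower_bound_prod q.roots fun w hw => by
    by_contra! hw'
    exact hq w hw' (isRoot_of_mem_roots hw)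
  refine ⟨‖q.leadingCoeff‖ * c, mul_pos (norm_pos_iff.2 (leadingCoeff_ne_zero.2 hq0)) hc,
    fun z hz => ?_⟩
  rw [hs.eval_eq_prod_roots, norm_mul, mul_assoc, hs.natDegree_eq_card_roots]
  exact mul_le_mul_of_nonneg_left (h z hz) (norm_nonneg _)

lemma exists_upper_bound (p : ℂ[X]) {n : ℕ} (hn : p.natDegree ≤ n) :
    ∃ C : ℝ, 0 ≤ C ∧ ∀ z : ℂ, 0 ≤ z.im → ‖p.eval z‖ ≤ C * ‖z + Complex.I‖ ^ n := by
  refine ⟨∑ i ∈ Finset.range (n + 1), ‖p.coeff i‖, by positivity, fun z hz => ?_⟩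
  rw [eval_eq_sum_range' (Nat.lt_succ_of_le hn), Finset.sum_mul]
  refine (norm_sum_le _ _).trans (Finset.sum_le_sum fun i hi => ?_)
  rw [norm_mul, norm_pow]
  refine mul_le_mul_of_nonneg_left ?_ (norm_nonneg _)
  exact (pow_le_pow_left₀ (norm_nonneg _) (norm_le_norm_add_I hz) i).trans
    (pow_le_pow_right₀ (one_le_norm_add_I hz) (Nat.lt_succ_iff.1 (Finset.mem_range.1 hi)))

/-- The quotient of two polynomials decays according to the difference of their degrees. -/
lemma exists_bound_div {p q : ℂ[X]} (hq : ∀ z : ℂ, 0 ≤ z.im → q.eval z ≠ 0) {m : ℕ}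
    (hpq : p.natDegree + m ≤ q.natDegree) :
    ∃ C : ℝ, 0 ≤ C ∧ ∀ z : ℂ, 0 ≤ z.im → ‖p.eval z / q.eval z‖ ≤ C / ‖z + Complex.I‖ ^ m := by
  obtain ⟨c, hc, hlow⟩ := exists_lower_bound hq
  obtain ⟨C, hC, hup⟩ := exists_upper_bound p (n := q.natDegree - m) (by omega)
  refine ⟨C / c, by positivity, fun z hz => ?_⟩
  have h1 : 0 < ‖z + Complex.I‖ := zero_lt_one.trans_le (one_le_norm_add_I hz)
  rw [norm_div]
  refine (div_le_div₀ (by positivity) (hup z hz) (by positivity) (hlow z hz)).trans (le_of_eq ?_)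
  have : ‖z + Complex.I‖ ^ q.natDegree =
      ‖z + Complex.I‖ ^ (q.natDegree - m) * ‖z + Complex.I‖ ^ m := by
    rw [← pow_add]; congr 1; omega
  rw [this]
  field_simp

lemma norm_le_div_one_add_sq {g : ℂ → ℂ} {C : ℝ} (hC : 0 ≤ C)
    (h : ∀ z : ℂ, 0 ≤ z.im → ‖g z‖ ≤ C / ‖z + Complex.I‖ ^ 2) (x : ℝ) :
    ‖g x‖ ≤ C * (1 + x ^ 2)⁻¹ := by
  refine (h x (by simp)).trans ?_
  rw [← div_eq_mul_inv]
  refine div_le_div_of_nonneg_left hC (by positivity) ?_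
  simpa using one_add_sq_le_norm_add_I_sq x le_rfl

lemma integrable_div {p q : ℂ[X]} (hq : ∀ z : ℂ, 0 ≤ z.im → q.eval z ≠ 0)
    (hpq : p.natDegree + 2 ≤ q.natDegree) :
    Integrable fun x : ℝ => p.eval (x : ℂ) / q.eval (x : ℂ) := by
  obtain ⟨C, hC, h⟩ := exists_bound_div hq hpq
  refine (integrable_inv_one_add_sq.const_mul C).mono' ?_
    (ae_of_all _ (norm_le_div_one_add_sq hC h))
  refine Continuous.aestronglyMeasurable ?_
  exact (p.continuous.comp Complex.continuous_ofReal).div₀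
    (q.continuous.comp Complex.continuous_ofReal) fun x => hq _ (by simp)

/-- The integral over the real line of a rational function without poles in the closed upper
half-plane vanishes. -/
lemma integral_div_eq_zero {p q : ℂ[X]} (hq : ∀ z : ℂ, 0 ≤ z.im → q.eval z ≠ 0)
    (hpq : p.natDegree + 2 ≤ q.natDegree) :
    ∫ x : ℝ, p.eval (x : ℂ) / q.eval (x : ℂ) = 0 := by
  obtain ⟨C, hC, hb⟩ := exists_bound_div hq hpq
  set h : ℂ → ℂ := fun z => p.eval z / q.eval z with hh
  have hd : ∀ z : ℂ, 0 ≤ z.im → DifferentiableAt ℂ h z := fun z hz =>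
    p.differentiable.differentiableAt.div q.differentiable.differentiableAt (hq z hz)
  have hsmall : ∀ z : ℂ, 0 ≤ z.im → ∀ R : ℝ, 0 < R → R ≤ ‖z‖ → ‖h z‖ ≤ C / R ^ 2 := by
    intro z hz R hR hRz
    refine (hb z hz).trans (div_le_div_of_nonneg_left hC (by positivity) ?_)
    exact pow_le_pow_left₀ hR.le (hRz.trans (norm_le_norm_add_I hz)) 2
  have hbound : ∀ R : ℝ, 0 < R → ‖∫ x in (-R)..R, h x‖ ≤ 4 * C / R := by
    intro R hR
    -- The contour is the rectangle `[-R, R] × [0, R]`. The other three sides have total length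
    -- `4R`, and the integrand there is at most `C / R²`.
    have key := Complex.integral_boundary_rect_eq_zero_of_differentiableOn h (-R : ℂ)
      (R + R * Complex.I) (fun z hz => (hd z (by
        simp only [Complex.neg_im, Complex.ofReal_im, neg_zero, Complex.add_im, Complex.mul_im,
          Complex.ofReal_re, Complex.I_im, mul_one, Complex.I_re, mul_zero, add_zero, zero_add,
          Set.uIcc_of_le hR.le] at hz
        exact hz.2.1)).differentiableWithinAt)
    simp only [Complex.neg_re, Complex.ofReal_re, Complex.neg_im, Complex.ofReal_im, neg_zero,
      Complex.ofReal_zero, zero_mul, add_zero, Complex.add_re, Complex.mul_re, Complex.I_re,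
      mul_zero, Complex.I_im, mul_one, sub_self, Complex.add_im, Complex.mul_im, zero_add,
      smul_eq_mul, Complex.ofReal_neg] at key
    have e1 : ‖∫ x in (-R)..R, h (x + R * Complex.I)‖ ≤ C / R ^ 2 * |R - -R| := by
      refine intervalIntegral.norm_integral_le_of_norm_le_const fun x _ => ?_
      refine hsmall _ (by simp [hR.le]) R hR ?_
      refine le_trans ?_ (Complex.abs_im_le_norm _)
      simp [abs_of_pos hR]
    have e2 : ‖∫ y in (0 : ℝ)..R, h (R + y * Complex.I)‖ ≤ C / R ^ 2 * |R - 0| := by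
      refine intervalIntegral.norm_integral_le_of_norm_le_const fun y hy => ?_
      rw [Set.uIoc_of_le hR.le] at hy
      refine hsmall _ (by simp [hy.1.le]) R hR ?_
      refine le_trans ?_ (Complex.abs_re_le_norm _)
      simp [abs_of_pos hR]
    have e3 : ‖∫ y in (0 : ℝ)..R, h (-R + y * Complex.I)‖ ≤ C / R ^ 2 * |R - 0| := by
      refine intervalIntegral.norm_integral_le_of_norm_le_const fun y hy => ?_
      rw [Set.uIoc_of_le hR.le] at hy
      refine hsmall _ (by simp [hy.1.le]) R hR ?_
      refine le_trans ?_ (Complex.abs_re_le_norm _)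
      simp [abs_of_pos hR]
    have e0 : ∫ x in (-R)..R, h x = (∫ x in (-R)..R, h (x + R * Complex.I)) -
        Complex.I * (∫ y in (0 : ℝ)..R, h (R + y * Complex.I)) +
        Complex.I * (∫ y in (0 : ℝ)..R, h (-R + y * Complex.I)) := by
      linear_combination key
    rw [e0]
    refine (norm_add_le _ _).trans ((add_le_add_left (norm_sub_le _ _) _).trans ?_)
    rw [norm_mul, norm_mul, Complex.norm_I, one_mul, one_mul]
    refine (add_le_add (add_le_add e1 e2) e3).trans (le_of_eq ?_)
    rw [sub_zero, sub_neg_eq_add, abs_of_pos hR, abs_of_pos (by linarith)]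
    field_simp
    ring
  have hlim := intervalIntegral_tendsto_integral (integrable_div hq hpq)
    Filter.tendsto_neg_atTop_atBot Filter.tendsto_id
  refine tendsto_nhds_unique hlim (squeeze_zero_norm' ?_
    (Filter.Tendsto.const_div_atTop Filter.tendsto_id (4 * C)))
  filter_upwards [Filter.eventually_gt_atTop 0] with R hR using hbound R hR

/-- The integral of the Poisson kernel. -/
lemma integral_poisson {w : ℂ} (hw : 0 < w.im) :
    Integrable (fun x : ℝ => (w - starRingEnd ℂ w) / ((x - w) * (x - starRingEnd ℂ w))) ∧
    ∫ x : ℝ, (w - starRingEnd ℂ w) / ((x - w) * (x - starRingEnd ℂ w)) =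
      2 * Real.pi * Complex.I := by
  obtain ⟨γ, hγ⟩ : ∃ γ : NNReal, (γ : ℝ) = w.im := ⟨w.im.toNNReal, Real.coe_toNNReal _ hw.le⟩
  have hne : γ ≠ 0 := by
    rintro rfl
    exact hw.ne hγ
  have h : ∀ x : ℝ, (w - starRingEnd ℂ w) / ((x - w) * (x - starRingEnd ℂ w)) =
      2 * Real.pi * Complex.I *
        -- Up to the factor `2πi` this is the density of the Cauchy distribution with location `Re
        -- w` and scale `Im w`, whose total mass is 1.
        ((ProbabilityTheory.cauchyPDFReal w.re γ x : ℝ) : ℂ) := by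
    intro x
    have e1 : ((x : ℂ) - w) * (x - starRingEnd ℂ w) = (((x - w.re) ^ 2 + w.im ^ 2 : ℝ) : ℂ) := by
      rw [show (x : ℂ) - starRingEnd ℂ w = starRingEnd ℂ (x - w) by simp, Complex.mul_conj,
        Complex.normSq_apply]
      congr 1
      simp only [Complex.sub_re, Complex.ofReal_re, Complex.sub_im, Complex.ofReal_im]
      ring
    have e2 : (x - w.re) ^ 2 + w.im ^ 2 ≠ 0 := by positivity
    rw [e1, Complex.sub_conj, ProbabilityTheory.cauchyPDFReal_def, hγ]
    have hpi : (Real.pi : ℂ) ≠ 0 := Complex.ofReal_ne_zero.2 Real.pi_ne_zero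
    have e3 : (((x - w.re) ^ 2 + w.im ^ 2 : ℝ) : ℂ) ≠ 0 := Complex.ofReal_ne_zero.2 e2
    push_cast at e3 ⊢
    field_simp
  simp only [h]
  refine ⟨(ProbabilityTheory.integrable_cauchyPDFReal _).ofReal.const_mul _, ?_⟩
  rw [integral_const_mul, integral_complex_ofReal,
    ProbabilityTheory.integral_cauchyPDFReal_eq_one _ hne]
  simp

/-- Cauchy's formula for a quotient of polynomials in the upper half-plane. -/
lemma integral_cauchy {p q : ℂ[X]} (hq : ∀ z : ℂ, 0 ≤ z.im → q.eval z ≠ 0)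
    (hpq : p.natDegree < q.natDegree) {w : ℂ} (hw : 0 < w.im) :
    Integrable (fun x : ℝ => p.eval (x : ℂ) * q.eval w / (q.eval (x : ℂ) * (x - w))) ∧
    ∫ x : ℝ, p.eval (x : ℂ) * q.eval w / (q.eval (x : ℂ) * (x - w)) =
      2 * Real.pi * Complex.I * p.eval w := by
  set w' := starRingEnd ℂ w with hw'
  -- Subtracting `p(w)` times the Poisson kernel removes the pole at `w`. What remains has
  -- denominator `q · (X - conj w)`, no poles in the closed upper half-plane and a degree drop of at
  -- least 2, so its integral is zero.
  set num : ℂ[X] := C (q.eval w) * p * (X - C w') - C (p.eval w * (w - w')) * q with hnum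
  obtain ⟨M, hM⟩ : X - C w ∣ num := by
    rw [dvd_iff_isRoot, IsRoot.def, hnum]
    simp only [eval_sub, eval_mul, eval_C, eval_X]
    ring
  have hq0 : q ≠ 0 := fun h => hq 0 le_rfl (by simp [h])
  have hdnum : num.natDegree ≤ q.natDegree := by
    refine (natDegree_sub_le _ _).trans (max_le ?_ (natDegree_C_mul_le _ _))
    refine natDegree_mul_le.trans ?_
    have := natDegree_C_mul_le (q.eval w) p
    rw [natDegree_X_sub_C]
    omega
  have hdM : M.natDegree + 2 ≤ (q * (X - C w')).natDegree := by
    rw [natDegree_mul hq0 (X_sub_C_ne_zero _), natDegree_X_sub_C]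
    rcases eq_or_ne M 0 with rfl | hM0
    · simp only [natDegree_zero]; omega
    · have := congrArg natDegree hM
      rw [natDegree_mul (X_sub_C_ne_zero _) hM0, natDegree_X_sub_C] at this
      omega
  have hq' : ∀ z : ℂ, 0 ≤ z.im → (q * (X - C w')).eval z ≠ 0 := by
    intro z hz
    rw [eval_mul, eval_sub, eval_X, eval_C]
    refine mul_ne_zero (hq z hz) (sub_ne_zero.2 fun h => ?_)
    rw [h, hw', Complex.conj_im] at hz
    linarith
  have hx : ∀ x : ℝ, p.eval (x : ℂ) * q.eval w / (q.eval (x : ℂ) * (x - w)) =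
      M.eval (x : ℂ) / (q * (X - C w')).eval (x : ℂ) +
        p.eval w * ((w - w') / ((x - w) * (x - w'))) := by
    intro x
    have h1 : (x : ℂ) - w ≠ 0 := sub_ne_zero.2 fun h => by
      rw [← h, Complex.ofReal_im] at hw
      exact lt_irrefl _ hw
    have h2 := hq' x (by simp)
    rw [eval_mul, eval_sub, eval_X, eval_C] at h2 ⊢
    have h3 := left_ne_zero_of_mul h2
    have h4 := right_ne_zero_of_mul h2
    have h5 := congrArg (eval (x : ℂ)) hM
    simp only [hnum, eval_sub, eval_mul, eval_C, eval_X] at h5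
    field_simp
    linear_combination h5
  obtain ⟨hi, he⟩ := integral_poisson hw
  simp only [hx]
  refine ⟨(integrable_div hq' hdM).add (hi.const_mul _), ?_⟩
  rw [integral_add (integrable_div hq' hdM) (hi.const_mul _), integral_div_eq_zero hq' hdM,
    integral_const_mul, he]
  ring

end HalfPlane

/-! ### Orthogonality for the weight `|E|⁻²`. -/

section Orthogonality

variable {N : ℕ} {a b : ℕ → ℝ}

lemma natDegree_phiC (ha : ∀ n : ℕ, 1 ≤ n → n < N → 0 < a n) (j : Fin N) :
    (phiC a b j).natDegree = j :=
  natDegree_eq_of_degree_eq_some (degree_phiC ha j j.2)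

lemma integrable_phi_mul_phi_div [NeZero N] (ha : ∀ n : ℕ, 1 ≤ n → n < N → 0 < a n)
    (j k : Fin N) :
    Integrable fun x : ℝ => aeval (x : ℂ) (phi a b (j + 1)) * aeval (x : ℂ) (phi a b (k + 1)) *
      (((‖(structurePolynomial N a b).eval (x : ℂ)‖ ^ 2 : ℝ) : ℂ))⁻¹ := by
  have hE := eval_structurePolynomial_ne_zero (b := b) ha
  -- `|E|²` is replaced by `E²`, which has the same modulus and makes the integrand rational.
  have h := integrable_div (p := phiC a b j * phiC a b k) (q := structurePolynomial N a b ^ 2)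
    (fun z hz => by rw [eval_pow]; exact pow_ne_zero 2 (hE z hz)) (by
      have h1 := natDegree_phiC (b := b) ha j
      have h2 := natDegree_phiC (b := b) ha k
      have h3 := natDegree_mul_le (p := phiC a b j) (q := phiC a b k)
      rw [natDegree_pow, (natDegree_structurePolynomial ha).1]
      omega)
  refine h.congr' ?_ (ae_of_all _ fun x => ?_)
  · refine Continuous.aestronglyMeasurable ?_
    refine Continuous.mul ?_ (Continuous.inv₀ ?_ fun x => ?_)
    · simp only [aeval_ofReal_eq]
      fun_prop
    · have := (structurePolynomial N a b).continuous
      fun_prop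
    · exact Complex.ofReal_ne_zero.2 (pow_ne_zero 2 (norm_ne_zero_iff.2 (hE x (by simp))))
  · simp [eval_map_algebraMap, div_eq_mul_inv]

/-- The function `K(·, w)` is the reproducing kernel for the weight `|E|⁻²`. -/
lemma integral_phi_mul_kernel [NeZero N] (ha : ∀ n : ℕ, 1 ≤ n → n < N → 0 < a n) (j : Fin N)
    {w : ℂ} (hw : 0 < w.im) :
    ∫ x : ℝ, aeval (x : ℂ) (phi a b (j + 1)) * kernel N a b x w *
      (((‖(structurePolynomial N a b).eval (x : ℂ)‖ ^ 2 : ℝ) : ℂ))⁻¹ =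
      Real.pi * aeval w (phi a b (j + 1)) := by
  have hE := eval_structurePolynomial_ne_zero (b := b) ha
  obtain ⟨dE, hE0⟩ := natDegree_structurePolynomial (b := b) ha
  set E := structurePolynomial N a b with hEdef
  have hdeg : (phiC a b j).natDegree < E.natDegree := by
    rw [natDegree_phiC ha, dE]; exact j.2
  obtain ⟨i1, e1⟩ := integral_cauchy hE hdeg hw
  set w' := starRingEnd ℂ w with hw'
  have hE' : ∀ z : ℂ, 0 ≤ z.im → (E * (X - C w')).eval z ≠ 0 := by
    intro z hz
    rw [eval_mul, eval_sub, eval_X, eval_C]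
    refine mul_ne_zero (hE z hz) (sub_ne_zero.2 fun h => ?_)
    rw [h, hw', Complex.conj_im] at hz
    linarith
  have hdeg' : (phiC a b j).natDegree + 2 ≤ (E * (X - C w')).natDegree := by
    rw [natDegree_mul hE0 (X_sub_C_ne_zero _), natDegree_X_sub_C]
    omega
  have i2 := integrable_div hE' hdeg'
  have e2 := integral_div_eq_zero hE' hdeg'
  -- On the real line `|E|² = E E#`, so the de Branges formula splits `K(x,w) / |E|²` in two. The
  -- part with `1 / E` gives `φⱼ(w)` by Cauchy's formula; the part with `1 / E#` is the conjugate of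
  -- a function without poles in the closed upper half-plane and integrates to zero.
  have hx : ∀ x : ℝ, aeval (x : ℂ) (phi a b (j + 1)) * kernel N a b x w *
      (((‖E.eval (x : ℂ)‖ ^ 2 : ℝ) : ℂ))⁻¹ =
      (2 * Complex.I)⁻¹ * ((phiC a b j).eval (x : ℂ) * E.eval w / (E.eval (x : ℂ) * (x - w)) -
        sharp (fun z => E.eval z) w * starRingEnd ℂ
          ((phiC a b j).eval (x : ℂ) / (E * (X - C w')).eval (x : ℂ))) := by
    intro x
    have h1 : (x : ℂ) - w ≠ 0 := sub_ne_zero.2 fun h => by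
      rw [← h, Complex.ofReal_im] at hw
      exact lt_irrefl _ hw
    have h2 := hE x (by simp)
    have h3 : starRingEnd ℂ (E.eval (x : ℂ)) ≠ 0 := by simpa using h2
    have key := structurePolynomial_mul_sharp_sub (b := b) ha x w
    have hsx : sharp (fun z => E.eval z) (x : ℂ) = starRingEnd ℂ (E.eval (x : ℂ)) := by
      simp [sharp]
    rw [← hEdef, hsx] at key
    simp only [eval_map_algebraMap, eval_mul, eval_sub, eval_X, eval_C, map_div₀, map_mul, map_sub,
      hw', Complex.conj_conj, Complex.conj_ofReal, ← aeval_conj_real]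
    rw [Complex.ofReal_pow, ← Complex.mul_conj']
    field_simp
    linear_combination (aeval (x : ℂ) (phi a b (j + 1))) * key
  simp only [hx]
  rw [integral_const_mul, integral_sub i1, integral_const_mul, integral_conj, e1, e2]
  · rw [eval_map_algebraMap]
    have := Complex.I_ne_zero
    simp only [map_zero, mul_zero, sub_zero]
    field_simp
  · exact (Complex.conjLIE.integrable_comp_iff.2 i2).const_mul _

/-- The polynomials `φⱼ` are orthogonal for the weight `|E|⁻²`. -/
lemma integral_phi_mul_phi_div [NeZero N] (ha : ∀ n : ℕ, 1 ≤ n → n < N → 0 < a n) (j k : Fin N) :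
    ∫ x : ℝ, aeval (x : ℂ) (phi a b (j + 1)) * aeval (x : ℂ) (phi a b (k + 1)) *
      (((‖(structurePolynomial N a b).eval (x : ℂ)‖ ^ 2 : ℝ) : ℂ))⁻¹ =
      if j = k then (Real.pi : ℂ) else 0 := by
  have hpi : (Real.pi : ℂ) ≠ 0 := Complex.ofReal_ne_zero.2 Real.pi_ne_zero
  have h := eq_ite_of_reproducing (b := b) ha (fun j k => (Real.pi : ℂ)⁻¹ *
    ∫ x : ℝ, aeval (x : ℂ) (phi a b (j + 1)) * aeval (x : ℂ) (phi a b (k + 1)) *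
      (((‖(structurePolynomial N a b).eval (x : ℂ)‖ ^ 2 : ℝ) : ℂ))⁻¹)
    {w : ℂ | 0 < w.im} (Or.inl ?_) (fun j w hw => ?_) j k
  · rw [inv_mul_eq_iff_eq_mul₀ hpi] at h
    rw [h]
    simp
  · refine Set.infinite_of_injective_forall_mem (f := fun n : ℕ => ((n : ℂ) + 1) * Complex.I) ?_ ?_
    · intro m n hmn
      simpa using hmn
    · intro n
      simp only [Set.mem_ofPred_eq, Complex.mul_im]
      simp
      positivity
  · have h1 := integral_phi_mul_kernel (b := b) ha j hw
    have h2 : ∀ x : ℝ, aeval (x : ℂ) (phi a b (j + 1)) * kernel N a b x w *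
        (((‖(structurePolynomial N a b).eval (x : ℂ)‖ ^ 2 : ℝ) : ℂ))⁻¹ =
        ∑ k : Fin N, aeval (x : ℂ) (phi a b (j + 1)) * aeval (x : ℂ) (phi a b (k + 1)) *
          (((‖(structurePolynomial N a b).eval (x : ℂ)‖ ^ 2 : ℝ) : ℂ))⁻¹ *
            aeval w (phi a b (k + 1)) := by
      intro x
      rw [kernel, Finset.mul_sum, Finset.sum_mul]
      exact Finset.sum_congr rfl fun k _ => by ring
    simp only [h2] at h1
    rw [integral_finsetSum _ fun k _ => (integrable_phi_mul_phi_div ha j k).mul_const _] at h1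
    simp only [integral_mul_const] at h1
    simp only [mul_assoc, ← Finset.mul_sum]
    rw [inv_mul_eq_iff_eq_mul₀ hpi, ← h1]
    simp only [mul_assoc]

/-- Parseval's identity in the de Branges space. -/
lemma inner_eq_deBrangesInner [NeZero N] (ha : ∀ n : ℕ, 1 ≤ n → n < N → 0 < a n)
    (c d : EuclideanSpace ℂ (Fin N)) :
    inner ℂ d c = deBrangesInner (fun z => (structurePolynomial N a b).eval z)
      (fourier N a b c) (fourier N a b d) := by
  have hpi : (Real.pi : ℂ) ≠ 0 := Complex.ofReal_ne_zero.2 Real.pi_ne_zero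
  rw [deBrangesInner]
  simp only [div_eq_mul_inv]
  rw [integral_fourier_mul_conj_fourier (integrable_phi_mul_phi_div ha)
    (integral_phi_mul_phi_div ha)]
  field_simp

end Orthogonality

/-! ### Hardy space: membership of rational functions and a pointwise bound. -/

section Hardy

/-- The quotient is `O(1 / ‖z + i‖)`, so its square is at most `C² / (1 + x²)` on every horizontal
line, uniformly in the height. -/
lemma memHardy_div {p q : ℂ[X]} (hq : ∀ z : ℂ, 0 ≤ z.im → q.eval z ≠ 0)
    (hpq : p.degree < q.natDegree) : MemHardy fun z => p.eval z / q.eval z := by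
  refine ⟨fun z hz => (p.differentiable.differentiableAt.div q.differentiable.differentiableAt
    (hq z (le_of_lt hz))).differentiableWithinAt, ?_⟩
  obtain ⟨C, hC, h⟩ : ∃ C : ℝ, 0 ≤ C ∧
      ∀ z : ℂ, 0 ≤ z.im → ‖p.eval z / q.eval z‖ ≤ C / ‖z + Complex.I‖ ^ 1 := by
    rcases eq_or_ne p 0 with rfl | hp
    · exact ⟨0, le_rfl, by simp⟩
    · have := (natDegree_lt_iff_degree_lt hp).2 hpq
      exact exists_bound_div hq this
  have hfin : ∫⁻ x : ℝ, ENNReal.ofReal (C ^ 2 * (1 + x ^ 2)⁻¹) ≠ ⊤ :=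
    (integrable_inv_one_add_sq.const_mul (C ^ 2)).lintegral_lt_top.ne
  refine ⟨(∫⁻ x : ℝ, ENNReal.ofReal (C ^ 2 * (1 + x ^ 2)⁻¹)).toNNReal, fun y hy => ?_⟩
  rw [ENNReal.coe_toNNReal hfin]
  refine lintegral_mono fun x => ?_
  rw [← ofReal_norm, ← ENNReal.ofReal_pow (norm_nonneg _)]
  refine ENNReal.ofReal_le_ofReal ?_
  refine (pow_le_pow_left₀ (norm_nonneg _) (h _ (by simp [hy.le])) 2).trans ?_
  rw [pow_one, div_pow, div_eq_mul_inv]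
  have := one_add_sq_le_norm_add_I_sq x hy.le
  gcongr

/-- The value of `|g|²` at a point is at most its mean over circles. -/
lemma enorm_sq_le_lintegral_circle {g : ℂ → ℂ} (hg : DifferentiableOn ℂ g {z : ℂ | 0 < z.im})
    {z : ℂ} {s : ℝ} (hs : 0 < s) (hsz : s < z.im) :
    ENNReal.ofReal (2 * Real.pi) * ‖g z‖ₑ ^ 2 ≤
      ∫⁻ θ in Set.Ioo (-Real.pi) Real.pi,
        ‖g (z + Complex.polarCoord.symm (s, θ))‖ₑ ^ 2 := by
  have hball : Metric.closedBall z s ⊆ {z : ℂ | 0 < z.im} := fun w hw => by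
    have h1 : |(w - z).im| ≤ s := (Complex.abs_im_le_norm _).trans (mem_closedBall_iff_norm.1 hw)
    rw [Complex.sub_im, abs_le] at h1
    change 0 < w.im
    linarith [h1.1]
  -- The mean value property is applied to the holomorphic function `g²`; taking norms then replaces
  -- subharmonicity of `|g|²`.
  have hd : DifferentiableOn ℂ (fun z => g z ^ 2) (closure (Metric.ball z |s|)) := by
    rw [abs_of_pos hs, closure_ball z hs.ne']
    exact (hg.pow 2).mono hball
  have havg := hd.diffContOnCl.circleAverage
  rw [Real.circleAverage_eq_integral_add (-Real.pi),
    intervalIntegral.integral_comp_add_right (fun θ => g (circleMap z s θ) ^ 2)] at havg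
  have h2 : (2 * Real.pi : ℝ) • g z ^ 2 =
      ∫ θ in Set.Ioo (-Real.pi) Real.pi, g (z + Complex.polarCoord.symm (s, θ)) ^ 2 := by
    rw [← havg, smul_inv_smul₀ (by positivity), zero_add,
      show 2 * Real.pi + -Real.pi = Real.pi by ring,
      intervalIntegral.integral_of_le (by linarith [Real.pi_pos]), integral_Ioc_eq_integral_Ioo]
    refine setIntegral_congr_fun measurableSet_Ioo fun θ _ => ?_
    simp only [circleMap, Complex.polarCoord_symm_apply, Complex.exp_mul_I, Complex.ofReal_cos,
      Complex.ofReal_sin]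
  calc ENNReal.ofReal (2 * Real.pi) * ‖g z‖ₑ ^ 2 = ‖(2 * Real.pi : ℝ) • g z ^ 2‖ₑ := by
        rw [enorm_smul, enorm_pow, Real.enorm_eq_ofReal (by positivity)]
    _ ≤ _ := by
        rw [h2]
        refine (enorm_integral_le_lintegral_enorm _).trans (le_of_eq ?_)
        simp only [enorm_pow]

/-- Functions in the Hardy space grow at most like `(Im z)^(-1/2)` near the real line. -/
lemma MemHardy.exists_bound {g : ℂ → ℂ} (hg : MemHardy g) :
    ∃ C : ℝ, 0 ≤ C ∧ ∀ z : ℂ, 0 < z.im → ‖g z‖ ^ 2 * z.im ≤ C := by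
  obtain ⟨hd, M, hM⟩ := hg
  refine ⟨8 * M, by positivity, fun z hz => ?_⟩
  -- The integral of `|g|²` over this strip of height `Im z` is at most `M Im z`. The strip contains
  -- the annulus `Im z / 4 < |w - z| < Im z / 2`, over which the circle means give at least `2π (Im
  -- z / 4)² |g(z)|²`.
  set S : Set ℂ := {w : ℂ | w.im ∈ Set.Ioo (z.im / 2) (3 * z.im / 2)} with hS
  have hSm : MeasurableSet S := Complex.measurable_im measurableSet_Ioo
  set G : ℂ → ENNReal := S.indicator fun w => ‖g w‖ₑ ^ 2 with hG
  have hGm : Measurable G := by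
    have hc : ContinuousOn g S := hd.continuousOn.mono fun w hw => by
      change 0 < w.im
      exact (half_pos hz).trans hw.1
    have hgm : Measurable (S.indicator g) := by
      classical
      rw [← Set.piecewise_eq_indicator]
      exact hc.measurable_piecewise continuousOn_const hSm
    have : G = fun w => ‖S.indicator g w‖ₑ ^ 2 := by
      ext w
      simp only [hG, Set.indicator_apply]
      split_ifs <;> simp
    rw [this]
    exact hgm.enorm.pow_const 2
  have hGm' : Measurable fun p : ℝ × ℝ => G (Complex.measurableEquivRealProd.symm p) :=
    hGm.comp Complex.measurableEquivRealProd.symm.measurable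
  have hupper : ∫⁻ w, G w ≤ M * ENNReal.ofReal z.im := by
    rw [← (Complex.volume_preserving_equiv_real_prod.symm).lintegral_comp_emb
      Complex.measurableEquivRealProd.symm.measurableEmbedding, Measure.volume_eq_prod,
      lintegral_prod_symm' _ hGm']
    have hy : ∀ y : ℝ, ∫⁻ x : ℝ, G (Complex.measurableEquivRealProd.symm (x, y)) ≤
        (Set.Ioo (z.im / 2) (3 * z.im / 2)).indicator (fun _ => (M : ENNReal)) y := by
      intro y
      by_cases hyS : y ∈ Set.Ioo (z.im / 2) (3 * z.im / 2)
      · rw [Set.indicator_of_mem hyS]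
        refine le_trans (lintegral_mono fun x => ?_) (hM y ((half_pos hz).trans hyS.1))
        refine (Set.indicator_le_self S (fun w => ‖g w‖ₑ ^ 2) _).trans (le_of_eq ?_)
        rw [Complex.measurableEquivRealProd_symm_apply, Complex.mk_eq_add_mul_I]
      · rw [Set.indicator_of_notMem hyS]
        refine le_of_eq (lintegral_eq_zero_of_ae_eq_zero (ae_of_all _ fun x => ?_))
        exact Set.indicator_of_notMem (s := S) (fun h => hyS h) fun w => ‖g w‖ₑ ^ 2
    refine (lintegral_mono hy).trans (le_of_eq ?_)
    rw [lintegral_indicator measurableSet_Ioo, setLIntegral_const, Real.volume_Ioo]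
    congr 2
    ring
  have hlower : ENNReal.ofReal (2 * Real.pi * (z.im / 4) ^ 2 * ‖g z‖ ^ 2) ≤ ∫⁻ w, G w := by
    rw [← lintegral_add_left_eq_self G z,
      ← Complex.lintegral_comp_polarCoord_symm (fun w => G (z + w)), polarCoord_target,
      Measure.volume_eq_prod, setLIntegral_prod _ ?_]
    · calc ENNReal.ofReal (2 * Real.pi * (z.im / 4) ^ 2 * ‖g z‖ ^ 2)
          = ∫⁻ _ in Set.Ioo (z.im / 4) (z.im / 2), ENNReal.ofReal (z.im / 4) *
              (ENNReal.ofReal (2 * Real.pi) * ‖g z‖ₑ ^ 2) := by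
            rw [setLIntegral_const, Real.volume_Ioo, ← ofReal_norm,
              ← ENNReal.ofReal_pow (norm_nonneg _), ← ENNReal.ofReal_mul (by positivity),
              ← ENNReal.ofReal_mul (by positivity), ← ENNReal.ofReal_mul (by positivity)]
            congr 1
            ring
        _ ≤ ∫⁻ s in Set.Ioo (z.im / 4) (z.im / 2), ∫⁻ θ in Set.Ioo (-Real.pi) Real.pi,
              ENNReal.ofReal s • G (z + Complex.polarCoord.symm (s, θ)) := by
            refine setLIntegral_mono' measurableSet_Ioo fun s hs => ?_
            have hs0 : 0 < s := (by positivity : 0 < z.im / 4).trans hs.1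
            simp only [smul_eq_mul]
            rw [lintegral_const_mul' _ _ ENNReal.ofReal_ne_top]
            refine mul_le_mul' (ENNReal.ofReal_le_ofReal hs.1.le) ?_
            refine (enorm_sq_le_lintegral_circle hd hs0 (by linarith [hs.2])).trans (le_of_eq ?_)
            refine lintegral_congr fun θ => ?_
            refine (Set.indicator_of_mem (s := S) ?_ fun w => ‖g w‖ₑ ^ 2).symm
            have h1 : |(Complex.polarCoord.symm (s, θ)).im| ≤ s := by
              refine (Complex.abs_im_le_norm _).trans ?_
              rw [Complex.norm_polarCoord_symm, abs_of_pos hs0]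
            rw [abs_le] at h1
            simp only [hS, Set.mem_ofPred_eq, Complex.add_im]
            exact ⟨by linarith [h1.1, hs.2], by linarith [h1.2, hs.2]⟩
        _ ≤ _ := lintegral_mono_set fun s hs => (by positivity : 0 < z.im / 4).trans hs.1
    · have hpm : Measurable fun p : ℝ × ℝ => Complex.polarCoord.symm p := by
        simp only [Complex.polarCoord_symm_apply]
        fun_prop
      exact ((measurable_fst.ennreal_ofReal).mul
        (hGm.comp (hpm.const_add z))).aemeasurable
  have h := hlower.trans hupper
  rw [← ENNReal.ofReal_coe_nnreal, ← ENNReal.ofReal_mul (by positivity),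
    ENNReal.ofReal_le_ofReal_iff (by positivity)] at h
  have h3 : z.im * (2 * Real.pi / 16 * (‖g z‖ ^ 2 * z.im)) ≤ z.im * M := by
    linarith
  have h4 := le_of_mul_le_mul_left h3 hz
  have h5 : 0 ≤ ‖g z‖ ^ 2 * z.im := by positivity
  nlinarith [Real.pi_gt_three]

end Hardy

/-! ### A Liouville theorem with a singularity along the real line. -/

section Entire

/-- An entire function bounded off the real line by `C (1 + |z|)^N |Im z|^(-1/2)` is a polynomial
of degree less than `N`. -/
lemma exists_polynomial_of_growth {F : ℂ → ℂ} (hF : Differentiable ℂ F) {C : ℝ} (hC : 0 ≤ C)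
    {N : ℕ} (h : ∀ z : ℂ, ‖F z‖ ^ 2 * |z.im| ≤ C * (1 + ‖z‖) ^ (2 * N)) :
    ∃ p : ℂ[X], p.degree < (N : WithBot ℕ) ∧ ∀ z, F z = p.eval z := by
  -- On `|z| = R` one has `|z² - R²| = 2R |Im z|`, so this factor absorbs the singularity `|Im
  -- z|^(-1/2)` at `±R`, and the maximum principle carries the bound inside.
  have hmax : ∀ R : ℝ, 1 ≤ R → ∀ z : ℂ, ‖z‖ ≤ R →
      ‖F z * (z ^ 2 - R ^ 2)‖ ≤ √(4 * C * 2 ^ (2 * N) * R ^ (2 * N + 3)) := by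
    intro R hR z hz
    have hR0 : 0 < R := by linarith
    refine Complex.norm_le_of_forall_mem_frontier_norm_le (f := fun z => F z * (z ^ 2 - R ^ 2))
      (U := Metric.ball 0 R) Metric.isBounded_ball ?_ ?_ ?_
    · exact (hF.mul ((differentiable_id.pow 2).sub_const _)).diffContOnCl
    · intro w hw
      rw [frontier_ball _ hR0.ne', mem_sphere_zero_iff_norm] at hw
      have hw2 : w ^ 2 - (R : ℂ) ^ 2 = w * (((2 * w.im : ℝ) : ℂ) * Complex.I) := by
        rw [← Complex.sub_conj, mul_sub, Complex.mul_conj', hw]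
        ring
      refine Real.le_sqrt_of_sq_le ?_
      rw [hw2, norm_mul, norm_mul, norm_mul, hw, Complex.norm_I, Complex.norm_real,
        Real.norm_eq_abs, abs_mul, abs_two]
      have him : |w.im| ≤ R := hw ▸ Complex.abs_im_le_norm w
      calc (‖F w‖ * (R * (2 * |w.im| * 1))) ^ 2
          = 4 * R ^ 2 * (‖F w‖ ^ 2 * |w.im|) * |w.im| := by ring
        _ ≤ 4 * R ^ 2 * (C * (1 + ‖w‖) ^ (2 * N)) * R := by
            have := h w
            gcongr
        _ ≤ 4 * R ^ 2 * (C * (2 * R) ^ (2 * N)) * R := by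
            rw [hw]
            gcongr
            linarith
        _ = 4 * C * 2 ^ (2 * N) * R ^ (2 * N + 3) := by
            rw [mul_pow]; ring
    · rw [closure_ball _ hR0.ne']
      simpa using hz
  have hsphere : ∀ R : ℝ, 1 ≤ R → ∀ z : ℂ, ‖z‖ = R / 2 →
      ‖F z‖ ≤ 2 * √(4 * C * 2 ^ (2 * N) * R ^ (2 * N + 3)) / R ^ 2 := by
    intro R hR z hz
    have h1 := hmax R hR z (by linarith)
    have h2 : R ^ 2 / 2 ≤ ‖z ^ 2 - (R : ℂ) ^ 2‖ := by
      have h3 := norm_sub_norm_le ((R : ℂ) ^ 2) (z ^ 2)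
      rw [norm_sub_rev, norm_pow, norm_pow, Complex.norm_real, Real.norm_eq_abs, sq_abs, hz] at h3
      nlinarith
    rw [norm_mul] at h1
    rw [le_div_iff₀ (by positivity)]
    have := (mul_le_mul_of_nonneg_left h2 (norm_nonneg (F z))).trans h1
    linarith
  -- On `|z| = R / 2` the bound is `O(R^(N - 1/2))`. The gain of one half over `N` lets Cauchy's
  -- estimate kill the coefficient `n = N` as well.
  have hzero : ∀ n, N ≤ n → iteratedDeriv n F 0 = 0 := by
    intro n hn
    have hb : ∀ R : ℝ, 1 ≤ R → ‖iteratedDeriv n F 0‖ ^ 2 ≤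
        ((n.factorial : ℝ) * 2 * 2 ^ n) ^ 2 * (4 * C * 2 ^ (2 * N)) / R := by
      intro R hR
      have hR0 : 0 < R := by linarith
      have h1 := Complex.norm_iteratedDeriv_le_of_forall_mem_sphere_norm_le n (c := 0)
        (R := R / 2) (by positivity) hF.diffContOnCl
        (fun z hz => hsphere R hR z (mem_sphere_zero_iff_norm.1 hz))
      refine (pow_le_pow_left₀ (norm_nonneg _) h1 2).trans ?_
      have e : (↑n.factorial * (2 * √(4 * C * 2 ^ (2 * N) * R ^ (2 * N + 3)) / R ^ 2) /
          (R / 2) ^ n) ^ 2 = ((n.factorial : ℝ) * 2 * 2 ^ n) ^ 2 * (4 * C * 2 ^ (2 * N)) *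
            (R ^ (2 * N + 3) / (R ^ 4 * R ^ (2 * n))) := by
        have := Real.sq_sqrt (show 0 ≤ 4 * C * 2 ^ (2 * N) * R ^ (2 * N + 3) by positivity)
        rw [div_pow, div_pow, mul_pow, div_pow, mul_pow 2, this]
        field_simp
        ring
      rw [e, div_eq_mul_inv (_ * _) R]
      refine mul_le_mul_of_nonneg_left ?_ (by positivity)
      rw [div_le_iff₀ (by positivity), ← pow_add, inv_mul_eq_div, le_div_iff₀ hR0, ← pow_succ]
      exact pow_le_pow_right₀ hR (by omega)
    have hlim : ‖iteratedDeriv n F 0‖ ^ 2 ≤ 0 := by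
      refine ge_of_tendsto (Filter.Tendsto.const_div_atTop Filter.tendsto_id
        (((n.factorial : ℝ) * 2 * 2 ^ n) ^ 2 * (4 * C * 2 ^ (2 * N)))) ?_
      filter_upwards [Filter.eventually_ge_atTop 1] with R hR using hb R hR
    have : ‖iteratedDeriv n F 0‖ = 0 := by
      nlinarith [norm_nonneg (iteratedDeriv n F 0)]
    exact norm_eq_zero.1 this
  refine ⟨∑ n ∈ Finset.range N, monomial n ((n.factorial : ℂ)⁻¹ * iteratedDeriv n F 0), ?_,
    fun z => ?_⟩
  · rw [← mem_degreeLT]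
    refine Submodule.sum_mem _ fun n hn => mem_degreeLT.2 ((degree_monomial_le _ _).trans_lt ?_)
    exact_mod_cast Finset.mem_range.1 hn
  · have h1 := Complex.hasSum_taylorSeries_of_entire hF 0 z
    have h2 := hasSum_sum_of_ne_finset_zero (L := .unconditional ℕ) (s := Finset.range N)
      (f := fun n : ℕ => (n.factorial : ℂ)⁻¹ • (z - 0) ^ n • iteratedDeriv n F 0) fun n hn => by
        rw [hzero n (by simpa using hn), smul_zero, smul_zero]
    rw [h1.unique h2, eval_finsetSum]
    refine Finset.sum_congr rfl fun n _ => ?_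
    rw [eval_monomial, sub_zero, smul_eq_mul, smul_eq_mul]
    ring

end Entire

/-! ### Identification of `B(E)` for polynomial `E`. -/

section DeBrangesSpace

lemma sharp_eval (p : ℂ[X]) (z : ℂ) :
    sharp (fun z => p.eval z) z = (p.map (starRingEnd ℂ)).eval z := by
  rw [sharp, ← eval_map_apply]
  simp

/-- The de Branges space of a polynomial without zeros in the closed upper half-plane. -/
lemma deBrangesSpace_eq_polynomials {q : ℂ[X]} (hq : ∀ z : ℂ, 0 ≤ z.im → q.eval z ≠ 0) :
    deBrangesSpace (fun z => q.eval z) =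
      {F : ℂ → ℂ | ∃ p : ℂ[X], p.degree < (q.natDegree : WithBot ℕ) ∧ ∀ z, F z = p.eval z} := by
  ext F
  constructor
  · rintro ⟨hF, h1, h2⟩
    obtain ⟨C1, hC1, b1⟩ := h1.exists_bound
    obtain ⟨C2, hC2, b2⟩ := h2.exists_bound
    obtain ⟨D, hD, hup⟩ := exists_upper_bound q le_rfl
    have key : ∀ (C : ℝ) (G : ℂ → ℂ), 0 ≤ C →
        (∀ z : ℂ, 0 < z.im → ‖G z / q.eval z‖ ^ 2 * z.im ≤ C) →
        ∀ z : ℂ, 0 < z.im → ‖G z‖ ^ 2 * z.im ≤ C * D ^ 2 * (1 + ‖z‖) ^ (2 * q.natDegree) := by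
      intro C G hC hG z hz
      have h3 := hG z hz
      have h4 : 0 < ‖q.eval z‖ := norm_pos_iff.2 (hq z hz.le)
      rw [norm_div, div_pow, div_mul_eq_mul_div, div_le_iff₀ (by positivity)] at h3
      refine h3.trans ?_
      rw [mul_assoc]
      refine mul_le_mul_of_nonneg_left ?_ hC
      refine (pow_le_pow_left₀ h4.le (hup z hz.le) 2).trans ?_
      rw [mul_pow, ← pow_mul, mul_comm q.natDegree 2]
      have h5 : ‖z + Complex.I‖ ≤ 1 + ‖z‖ := by
        refine (norm_add_le _ _).trans ?_
        rw [Complex.norm_I, add_comm]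
      gcongr
    -- `F / E` controls `F` above the real line and `F# / E` controls it below; on the line the
    -- factor `|Im z|` makes the bound trivial.
    refine exists_polynomial_of_growth hF (C := (C1 + C2) * D ^ 2) (by positivity) fun z => ?_
    rcases lt_trichotomy z.im 0 with hz | hz | hz
    · have hz' : 0 < (starRingEnd ℂ z).im := by
        rw [Complex.conj_im]; linarith
      have h3 := key C2 _ hC2 b2 _ hz'
      simp only [sharp, Complex.conj_conj, Complex.norm_conj, Complex.conj_im] at h3
      rw [abs_of_neg hz]
      refine h3.trans ?_
      gcongr
      linarith
    · rw [hz, abs_zero, mul_zero]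
      positivity
    · rw [abs_of_pos hz]
      refine (key C1 F hC1 b1 z hz).trans ?_
      gcongr
      linarith
  · rintro ⟨p, hp, hF⟩
    obtain rfl : F = fun z => p.eval z := funext hF
    refine ⟨p.differentiable, memHardy_div hq hp, ?_⟩
    simp only [sharp_eval]
    exact memHardy_div hq (by rwa [degree_map])

end DeBrangesSpace

/-! ### Reachable states, the connecting form and the kernel at `i`. -/

section Reachability

variable {N : ℕ} [NeZero N] {a b : ℕ → ℝ} {T : ℝ}
  {W : Control T →L[ℂ] EuclideanSpace ℂ (Fin N)}

lemma fourierReachable_eq_range (hW : IsControlOperator N a b T W) (hs : Function.Surjective W) :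
    fourierReachable N a b T = Set.range (fourier N a b) := by
  have : reachableSet N a b T = Set.univ := by
    refine Set.eq_univ_of_forall fun x => ?_
    obtain ⟨f, rfl⟩ := hs x
    obtain ⟨u, hu⟩ := (hW f).1
    exact ⟨f, u, hu, ((hW f).2 u hu).symm⟩
  rw [fourierReachable, this, Set.image_univ]

lemma connectingForm_eq_inner {N : ℕ} {T : ℝ} (W : Control T →L[ℂ] EuclideanSpace ℂ (Fin N))
    (h g : Control T) : connectingForm W h g = inner ℂ (W g) (W h) := by
  rw [connectingForm, connectingOperator, ContinuousLinearMap.comp_apply,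
    ContinuousLinearMap.adjoint_inner_right]

end Reachability

/-- The coefficients of the reproducing kernel at `i`. -/
def kernelCoeff (N : ℕ) (a b : ℕ → ℝ) : EuclideanSpace ℂ (Fin N) :=
  WithLp.toLp 2 fun k => aeval (-Complex.I) (phi a b (k + 1))

lemma fourier_kernelCoeff (N : ℕ) (a b : ℕ → ℝ) (z : ℂ) :
    fourier N a b (kernelCoeff N a b) z = kernel N a b z (-Complex.I) := by
  simp [fourier, kernelCoeff, kernel, mul_comm]

/-- The entries `φₖ(-i)` are conjugated by the first slot of the inner product and become `φₖ(i)`.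
-/
lemma inner_kernelCoeff (N : ℕ) (a b : ℕ → ℝ) (c : EuclideanSpace ℂ (Fin N)) :
    inner ℂ (kernelCoeff N a b) c = fourier N a b c Complex.I := by
  rw [PiLp.inner_apply, fourier]
  refine Finset.sum_congr rfl fun k _ => ?_
  rw [RCLike.inner_apply, kernelCoeff, ← aeval_conj_real, map_neg, Complex.conj_I, neg_neg]

end JacobiDeBranges

end

theorem mainTheorem1 (N : ℕ) [NeZero N] (a b : ℕ → ℝ)
    (ha : ∀ n : ℕ, 1 ≤ n → n < N → 0 < a n) (T : ℝ) (hT : 0 < T) :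
    ∃ W : JacobiDeBranges.Control T →L[ℂ] EuclideanSpace ℂ (Fin N),
      JacobiDeBranges.IsControlOperator N a b T W ∧
      -- the Fourier images of the reachable set
      JacobiDeBranges.fourierReachable N a b T =
        (Submodule.span ℂ (Set.range fun k : Fin N =>
          fun z : ℂ => Polynomial.aeval z (JacobiDeBranges.phi a b (k + 1))) : Set (ℂ → ℂ)) ∧
      JacobiDeBranges.fourierReachable N a b T =
        {F : ℂ → ℂ | ∃ p : Polynomial ℂ, p.degree < (N : WithBot ℕ) ∧ ∀ z, F z = p.eval z} ∧
      -- the form of the connecting operator is the scalar product of `L₂` of the spectral measure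
      (∀ h g : JacobiDeBranges.Control T,
        JacobiDeBranges.connectingForm W h g =
          ∫ x : ℝ, JacobiDeBranges.fourier N a b (W h) (x : ℂ) *
            starRingEnd ℂ (JacobiDeBranges.fourier N a b (W g) (x : ℂ))
            ∂(JacobiDeBranges.spectralMeasure N a b)) ∧
      -- `J_i = fourier (W j)` is the reproducing kernel at `i`, and `E` is built from it
      ∃ (j : JacobiDeBranges.Control T) (E : ℂ → ℂ),
        (∀ g : JacobiDeBranges.Control T,
          JacobiDeBranges.connectingForm W g j =
            JacobiDeBranges.fourier N a b (W g) Complex.I) ∧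
        (∀ z : ℂ, E z = (1 - Complex.I * z) * JacobiDeBranges.fourier N a b (W j) z /
          ((Real.sqrt (JacobiDeBranges.connectingForm W j j).re : ℝ) : ℂ)) ∧
        -- the space of Fourier images, with the form of the connecting operator, is `B(E)`
        JacobiDeBranges.IsHermiteBiehler E ∧
        JacobiDeBranges.fourierReachable N a b T = JacobiDeBranges.deBrangesSpace E ∧
        ∀ h g : JacobiDeBranges.Control T,
          JacobiDeBranges.connectingForm W h g =
            JacobiDeBranges.deBrangesInner E (JacobiDeBranges.fourier N a b (W h))
              (JacobiDeBranges.fourier N a b (W g)) := by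
  obtain ⟨W, hW, hs⟩ := JacobiDeBranges.exists_controlOperator_surjective (b := b) ha hT
  have hreach := JacobiDeBranges.fourierReachable_eq_range hW hs
  obtain ⟨dE, _⟩ := JacobiDeBranges.natDegree_structurePolynomial (b := b) ha
  -- Surjectivity supplies a control that steers the system to the coefficient vector of `J_i`.
  obtain ⟨j, hj⟩ := hs (JacobiDeBranges.kernelCoeff N a b)
  have hjj : JacobiDeBranges.connectingForm W j j =
      (JacobiDeBranges.kernelNormSq N a b : ℂ) := by
    rw [JacobiDeBranges.connectingForm_eq_inner, hj, JacobiDeBranges.inner_kernelCoeff,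
      JacobiDeBranges.fourier_kernelCoeff, JacobiDeBranges.kernel_I_neg_I]
  refine ⟨W, hW, hreach.trans JacobiDeBranges.range_fourier_eq_span,
    hreach.trans (JacobiDeBranges.range_fourier_eq_polynomials ha), fun h g => ?_,
    j, fun z => (JacobiDeBranges.structurePolynomial N a b).eval z, fun g => ?_, fun z => ?_,
    JacobiDeBranges.isHermiteBiehler_structurePolynomial ha, ?_, fun h g => ?_⟩
  · rw [JacobiDeBranges.connectingForm_eq_inner,
      JacobiDeBranges.inner_eq_integral_spectralMeasure ha]
  · rw [JacobiDeBranges.connectingForm_eq_inner, hj, JacobiDeBranges.inner_kernelCoeff]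
  · rw [hjj, Complex.ofReal_re, hj, JacobiDeBranges.fourier_kernelCoeff]
    exact JacobiDeBranges.eval_structurePolynomial_eq_kernel ha z
  · rw [hreach, JacobiDeBranges.range_fourier_eq_polynomials ha,
      JacobiDeBranges.deBrangesSpace_eq_polynomials
        (JacobiDeBranges.eval_structurePolynomial_ne_zero ha), dE]
  · rw [JacobiDeBranges.connectingForm_eq_inner, JacobiDeBranges.inner_eq_deBrangesInner ha]
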